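/- **Conventions.** Let $T$ be a (possibly many-sorted) first-order theory with quantifier elimination and elimination of imaginaries; no stability is assumed. Elimination of imaginaries means: in every model of $T$, every class $\theta(M,a)$ of a $\emptyset$-definable equivalence relation $\theta$ on a finite product of sorts equals $\psi(M,b)$ for some formula $\psi(x,z)$ and a unique finite tuple $b$. For a subset $A$ of a model of $T$, let $\mathcal G(A)=\mathrm{Aut}(\mathrm{acl}(A)/\mathrm{dcl}(A))$ with the topology of pointwise convergence on $\mathrm{acl}(A)$ (a profinite group), and for $A\subseteq B$ let $\mathcal G(B/A)=\mathrm{Aut}(\mathrm{dcl}(B)/\mathrm{dcl}(A))$. For a sort $J$, $\mathrm{Aut}_J(B/A)$ is the group of permutations of the elements of sort $J$ of $\mathrm{dcl}(B)$ induced by $\mathcal G(B/A)$. For $H\le\mathcal G(A)$, $\mathrm{acl}(A)^H$ is the set of points of $\mathrm{acl}(A)$ fixed by $H$. A continuous epimorphism $\pi:\mathcal G(F)\to\mathcal G(E)$ is *sorted* if for every open normal subgroup $H$ of $\mathcal G(E)$ and every sort $J$, $$|\mathrm{Aut}_J(\mathrm{acl}(E)^H/E)|=|\mathcal G(\mathrm{acl}(E)^H/E)|\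 \Longrightarrow\ |\mathrm{Aut}_J(\mathrm{acl}(F)^{\pi^{-1}[H]}/F)|=|\mathcal G(\mathrm{acl}(F)^{\pi^{-1}[H]}/F)|.$$ A *sorted isomorphism* is an isomorphism of topological groups $\pi$ such that $\pi$ and $\pi^{-1}$ are sorted. Let $\mathbb C\models T$, let $\mathcal U$ be an ultrafilter on a set $I$, and let $\mathbb C^*=\prod_{\mathcal U}\mathbb C$ be the ultrapower, whose elements of a sort $s$ are the classes of sequences of elements of $\mathbb C$ of sort $s$. For subsets $F_i\subseteq\mathbb C$ ($i\in I$), $\prod_{\mathcal U}F_i\subseteq\mathbb C^*$ is the set of classes of sequences $(a_i)$ with $a_i\in F_i$ for $\mathcal U$-many $i$. For $\sigma_i\in\mathcal G(F_i)$, $\tau\in\mathcal G(\prod_{\mathcal U}F_i)$ and $X\subseteq\mathrm{acl}(\prod_{\mathcal U}F_i)$, say that *$\tau=\lim_{\mathcal U}\sigma_i$ on $X$* if every $x\in X$ is the class of a sequence $(c_i)$ with $c_i\in\mathrm{acl}(F_i)$ for $\mathcal U$-many $i$, and $\tau(x)$ is the class of $(\sigma_i(c_i))$. **Lemma.** Let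 $E_i,F_i$ ($i\in I$) be definably closed substructures of $\mathbb C$, and for each $i\in I$ let $\varphi_i:\mathcal G(F_i)\to\mathcal G(E_i)$ be a sorted isomorphism. Put $E^*=\prod_{\mathcal U}E_i$ and $F^*=\prod_{\mathcal U}F_i$. Then there is a sorted isomorphism $\Phi:\mathcal G(F^*)\to\mathcal G(E^*)$. Moreover, $\Phi$ can be chosen to be induced, at every finite level, by the ultralimits of the $\varphi_i$: for every open normal subgroup $H$ of $\mathcal G(F^*)$, with $N=\mathrm{acl}(F^*)^H$ and $M=\mathrm{acl}(E^*)^{\Phi(H)}$, and every $\tau\in\mathcal G(F^*)$, there are $\sigma_i\in\mathcal G(F_i)$ $(i\in I)$ with $\tau=\lim_{\mathcal U}\sigma_i$ on $N$, and for every such sequence $(\sigma_i)$ we have $\Phi(\tau)=\lim_{\mathcal U}\varphi_i(\sigma_i)$ on $M$. -/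

import Mathlib

universe u

noncomputable section

namespace ManySorted

/-! ### Many-sorted first-order logic -/

section Logic

variable {S : Type u}

/-- A finite list `Γ` of sorts is a context; `Var Γ s` is the set of positions of `Γ` of sort `s`,
i.e. the variables of sort `s` in the context `Γ`. -/
inductive Var : List S → S → Type u
  | zero {s : S} {Γ : List S} : Var (s :: Γ) s
  | succ {s t : S} {Γ : List S} : Var Γ s → Var (t :: Γ) s

/-- Elements of `M s₁ × ⋯ × M sₙ` for `Γ = [s₁, …, sₙ]`. -/
abbrev Tuple (M : S → Type u) (Γ : List S) : Type u := ∀ s, Var Γ s → M s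

/-- The empty tuple. -/
def Tuple.nil {M : S → Type u} : Tuple M [] := fun _ i => nomatch i

/-- The tuple `(x, v₁, …, vₙ)`. -/
def Tuple.cons {M : S → Type u} {t : S} {Γ : List S} (x : M t) (v : Tuple M Γ) :
    Tuple M (t :: Γ)
  | _, .zero => x
  | s, .succ j => v s j

/-- Concatenation of tuples. -/
def Tuple.append {M : S → Type u} : {Γ Δ : List S} → Tuple M Γ → Tuple M Δ → Tuple M (Γ ++ Δ)
  | [], _, _, v => v
  | _ :: _, _, u, v => Tuple.cons (u _ .zero) (Tuple.append (fun s i => u s (.succ i)) v)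

/-- A language whose set of sorts is `S`. -/
structure Language (S : Type u) : Type (u + 1) where
  /-- function symbols `s₁ × ⋯ × sₙ → s` -/
  Functions : List S → S → Type u
  /-- relation symbols on `s₁ × ⋯ × sₙ` -/
  Relations : List S → Type u

/-- Terms with variables in the context `Γ`, indexed by their sort. -/
inductive Term (L : Language S) (Γ : List S) : S → Type u
  | var {s : S} (i : Var Γ s) : Term L Γ s
  | func {Δ : List S} {s : S} (f : L.Functions Δ s) (ts : ∀ t, Var Δ t → Term L Γ t) : Term L Γ s

/-- First-order formulas with free variables in the context `Γ`; a quantifier binds the first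
variable of the context. -/
inductive Formula (L : Language S) : List S → Type u
  | falsum {Γ : List S} : Formula L Γ
  | equal {Γ : List S} {s : S} (t₁ t₂ : Term L Γ s) : Formula L Γ
  | rel {Γ Δ : List S} (R : L.Relations Δ) (ts : ∀ t, Var Δ t → Term L Γ t) : Formula L Γ
  | imp {Γ : List S} (φ ψ : Formula L Γ) : Formula L Γ
  | all {Γ : List S} {s : S} (φ : Formula L (s :: Γ)) : Formula L Γ

/-- The formula contains no quantifier. -/
def Formula.IsQF {L : Language S} : {Γ : List S} → Formula L Γ → Prop
  | _, .falsum => True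
  | _, .equal _ _ => True
  | _, .rel _ _ => True
  | _, .imp φ ψ => φ.IsQF ∧ ψ.IsQF
  | _, .all _ => False

/-- `L`-structures with carrier `M s` of sort `s`. -/
class Structure (L : Language S) (M : S → Type u) : Type u where
  /-- interpretation of function symbols -/
  funMap : ∀ {Δ : List S} {s : S}, L.Functions Δ s → Tuple M Δ → M s
  /-- interpretation of relation symbols -/
  relMap : ∀ {Δ : List S}, L.Relations Δ → Tuple M Δ → Prop

/-- The value of a term. -/
def Term.realize {L : Language S} {M : S → Type u} [Structure L M] {Γ : List S} (v : Tuple M Γ) :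
    {s : S} → Term L Γ s → M s
  | _, .var i => v _ i
  | _, .func f ts => Structure.funMap f (fun t i => (ts t i).realize v)

/-- Satisfaction of a formula. -/
def Formula.Realize {L : Language S} {M : S → Type u} [Structure L M] :
    {Γ : List S} → Formula L Γ → Tuple M Γ → Prop
  | _, .falsum, _ => False
  | _, .equal t₁ t₂, v => t₁.realize v = t₂.realize v
  | _, .rel R ts, v => Structure.relMap R (fun t i => (ts t i).realize v)
  | _, .imp φ ψ, v => φ.Realize v → ψ.Realize v
  | _, .all (s := s) φ, v => ∀ x : M s, φ.Realize (Tuple.cons x v)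

/-- A theory is a set of sentences, i.e. of formulas in the empty context. -/
abbrev Theory (L : Language S) : Type u := Set (Formula L [])

/-- `M` is a model of the theory `T`. -/
def Theory.IsModel {L : Language S} (T : Theory L) (M : S → Type u) [Structure L M] : Prop :=
  ∀ φ ∈ T, φ.Realize (Tuple.nil : Tuple M [])

/-- Quantifier elimination: modulo `T`, every formula is equivalent to a quantifier-free formula
in the same free variables. -/
def Theory.HasQE {L : Language S} (T : Theory L) : Prop :=
  ∀ (Γ : List S) (φ : Formula L Γ), ∃ ψ : Formula L Γ, ψ.IsQF ∧
    ∀ (M : S → Type u) [Structure L M], T.IsModel M →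
      ∀ v : Tuple M Γ, φ.Realize v ↔ ψ.Realize v

/-- Elimination of imaginaries: in every model of `T`, every class `θ(M, a)` of every equivalence
relation `θ` definable without parameters on a finite product of sorts has a canonical parameter,
i.e. `θ(M, a) = ψ(M, b)` for some formula `ψ(x, z)` and a unique finite tuple `b`. -/
def Theory.HasEI {L : Language S} (T : Theory L) : Prop :=
  ∀ (M : S → Type u) [Structure L M], T.IsModel M →
    ∀ (Δ : List S) (θ : Formula L (Δ ++ Δ)),
      Equivalence (fun x y : Tuple M Δ => θ.Realize (Tuple.append x y)) →
      ∀ a : Tuple M Δ, ∃ (Λ : List S) (ψ : Formula L (Δ ++ Λ)), ∃! b : Tuple M Λ,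
        ∀ x : Tuple M Δ, θ.Realize (Tuple.append x a) ↔ ψ.Realize (Tuple.append x b)

end Logic

/-! ### Definable and algebraic closure, Galois groups -/

section Galois

variable {S : Type u} (L : Language S) {M : S → Type u} [Structure L M]

/-- Definable closure: `x ∈ dcl A` if `{x}` is defined by a formula with parameters from `A`. -/
def dcl (A : ∀ s, Set (M s)) (s : S) : Set (M s) :=
  {x | ∃ (Δ : List S) (φ : Formula L (s :: Δ)) (b : Tuple M Δ), (∀ t i, b t i ∈ A t) ∧
    ∀ y : M s, φ.Realize (Tuple.cons y b) ↔ y = x}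

/-- Algebraic closure: `x ∈ acl A` if `x` lies in a finite set defined by a formula with
parameters from `A`. -/
def acl (A : ∀ s, Set (M s)) (s : S) : Set (M s) :=
  {x | ∃ (Δ : List S) (φ : Formula L (s :: Δ)) (b : Tuple M Δ), (∀ t i, b t i ∈ A t) ∧
    φ.Realize (Tuple.cons x b) ∧ {y : M s | φ.Realize (Tuple.cons y b)}.Finite}

/-- `A` is a definably closed substructure of `M` (closure under the function symbols is part of
being definably closed). -/
def IsDefinablyClosed (A : ∀ s, Set (M s)) : Prop := ∀ s, dcl L A s ⊆ A s

/-- The group `Aut(B/A)` of automorphisms of the structure induced on `B ⊆ M` that fix `A`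
pointwise: families of permutations of the sorts of `B` which preserve in both directions the
relation symbols and the graphs of the function symbols. (If `B` is a substructure, the second
condition says that the family commutes with the function symbols.) -/
def autGroup (B A : ∀ s, Set (M s)) : Subgroup (∀ s, Equiv.Perm (B s)) where
  carrier := {σ |
    (∀ (Δ : List S) (s : S) (f : L.Functions Δ s) (x : ∀ t, Var Δ t → B t) (y : B s),
      Structure.funMap f (fun t i => (x t i : M t)) = (y : M s) ↔
        Structure.funMap f (fun t i => (σ t (x t i) : M t)) = (σ s y : M s)) ∧
    (∀ (Δ : List S) (R : L.Relations Δ) (x : ∀ t, Var Δ t → B t),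
      Structure.relMap R (fun t i => (x t i : M t)) ↔
        Structure.relMap R (fun t i => (σ t (x t i) : M t))) ∧
    ∀ (s : S) (x : B s), (x : M s) ∈ A s → σ s x = x}
  mul_mem' := by
    rintro σ τ ⟨hf, hr, ha⟩ ⟨hf', hr', ha'⟩
    refine ⟨fun Δ s f x y => ?_, fun Δ R x => ?_, fun s x hx => ?_⟩
    · exact (hf' Δ s f x y).trans (hf Δ s f (fun t i => τ t (x t i)) (τ s y))
    · exact (hr' Δ R x).trans (hr Δ R (fun t i => τ t (x t i)))
    · show σ s (τ s x) = x
      rw [ha' s x hx, ha s x hx]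
  one_mem' := ⟨fun _ _ _ _ _ => Iff.rfl, fun _ _ _ => Iff.rfl, fun _ _ _ => rfl⟩
  inv_mem' := by
    rintro σ ⟨hf, hr, ha⟩
    refine ⟨fun Δ s f x y => ?_, fun Δ R x => ?_, fun s x hx => ?_⟩
    · simpa using (hf Δ s f (fun t i => (σ t)⁻¹ (x t i)) ((σ s)⁻¹ y)).symm
    · simpa using (hr Δ R (fun t i => (σ t)⁻¹ (x t i))).symm
    · show (σ s)⁻¹ x = x
      rw [Equiv.Perm.inv_eq_iff_eq, ha s x hx]

/-- `𝒢(B/A) = Aut(dcl(B)/dcl(A))`. -/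
def relGal (B A : ∀ s, Set (M s)) : Subgroup (∀ s, Equiv.Perm (dcl L B s)) :=
  autGroup L (dcl L B) (dcl L A)

/-- `Aut_J(B/A)`: the group of permutations of the elements of sort `J` induced by `𝒢(B/A)`. -/
def autSort (B A : ∀ s, Set (M s)) (J : S) : Subgroup (Equiv.Perm (dcl L B J)) :=
  (relGal L B A).map (Pi.evalMonoidHom (fun s => Equiv.Perm (dcl L B s)) J)

/-- The absolute Galois group `𝒢(A) = Aut(acl(A)/dcl(A))`. -/
def AbsGal (A : ∀ s, Set (M s)) : Type u := autGroup L (acl L A) (dcl L A)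

instance (A : ∀ s, Set (M s)) : Group (AbsGal L A) :=
  inferInstanceAs (Group (autGroup L (acl L A) (dcl L A)))

variable {L}

/-- The action of `σ ∈ 𝒢(A)` on `acl(A)`. -/
def AbsGal.act {A : ∀ s, Set (M s)} (σ : AbsGal L A) (s : S) (x : acl L A s) : acl L A s :=
  σ.1 s x

/-- The topology of pointwise convergence on `acl(A)` (with each orbit finite, this is the
profinite topology). -/
instance (A : ∀ s, Set (M s)) : TopologicalSpace (AbsGal L A) :=
  TopologicalSpace.generateFrom
    {V | ∃ (s : S) (x y : acl L A s), V = {σ : AbsGal L A | σ.act s x = y}}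

/-- `acl(A)^H`, the elements of `acl(A)` fixed by `H ≤ 𝒢(A)`. -/
def fixedPoints {A : ∀ s, Set (M s)} (H : Subgroup (AbsGal L A)) (s : S) : Set (M s) :=
  {x | ∃ h : x ∈ acl L A s, ∀ σ ∈ H, σ.act s ⟨x, h⟩ = ⟨x, h⟩}

/-- `π : 𝒢(F) → 𝒢(E)` is sorted: for every open normal subgroup `H` of `𝒢(E)` and every sort `J`,
if `|Aut_J(acl(E)^H/E)| = |𝒢(acl(E)^H/E)|` then
`|Aut_J(acl(F)^(π⁻¹[H])/F)| = |𝒢(acl(F)^(π⁻¹[H])/F)|`. -/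
def IsSorted {F E : ∀ s, Set (M s)} (π : AbsGal L F →* AbsGal L E) : Prop :=
  ∀ H : Subgroup (AbsGal L E), H.Normal → IsOpen (H : Set (AbsGal L E)) → ∀ J : S,
    Cardinal.mk (autSort L (fixedPoints H) E J) = Cardinal.mk (relGal L (fixedPoints H) E) →
    Cardinal.mk (autSort L (fixedPoints (H.comap π)) F J) =
      Cardinal.mk (relGal L (fixedPoints (H.comap π)) F)

/-- A sorted isomorphism: an isomorphism of topological groups which is sorted and whose inverse
is sorted. -/
def IsSortedIso {F E : ∀ s, Set (M s)} (π : AbsGal L F ≃ₜ* AbsGal L E) : Prop :=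
  IsSorted (π : AbsGal L F →* AbsGal L E) ∧ IsSorted (π.symm : AbsGal L E →* AbsGal L F)

end Galois

/-! ### Ultraproducts -/

section Ultra

variable {S : Type u} {L : Language S} {I : Type u} (U : Ultrafilter I)

/-- The ultrapower `M* = ∏_U M`: its elements of sort `s` are the classes of sequences of
elements of `M` of sort `s`. -/
abbrev Ultrapower (M : S → Type u) (s : S) : Type u := Filter.Germ (U : Filter I) (M s)

/-- A sequence of elements of `M` representing an element of `M*`. -/
def Ultrapower.rep {M : S → Type u} {s : S} (x : Ultrapower U M s) : I → M s :=
  Classical.choose (Quotient.exists_rep x)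

theorem Ultrapower.coe_rep {M : S → Type u} {s : S} (x : Ultrapower U M s) :
    ((Ultrapower.rep U x : I → M s) : Ultrapower U M s) = x :=
  Classical.choose_spec (Quotient.exists_rep x)

/-- The symbols are interpreted in `M*` componentwise on representatives. -/
instance (M : S → Type u) [Structure L M] : Structure L (Ultrapower U M) where
  funMap f x := ((fun i => Structure.funMap f (fun t j => Ultrapower.rep U (x t j) i) : I → _) :
    Filter.Germ (U : Filter I) _)
  relMap R x := ∀ᶠ i in (U : Filter I),
    Structure.relMap R (fun t j => Ultrapower.rep U (x t j) i)

/-- The ultraproduct `∏_U F_i` as a subset of `M*`: the classes of the sequences `(a_i)` with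
`a_i ∈ F_i` for `U`-many `i`. -/
def ultraproduct {M : S → Type u} (F : I → ∀ s, Set (M s)) (s : S) : Set (Ultrapower U M s) :=
  {x | ∃ a : I → M s, x = (a : Ultrapower U M s) ∧ ∀ᶠ i in (U : Filter I), a i ∈ F i s}

variable {U} in
/-- On the elements of `X`, the automorphism `τ ∈ 𝒢(∏_U F_i)` is the ultralimit of the sequence
`(σ_i)`, `σ_i ∈ 𝒢(F_i)`: every `x ∈ X ∩ acl(∏_U F_i)` is the class of a sequence `(c_i)` with
`c_i ∈ acl(F_i)` for `U`-many `i`, and `τ(x)` is the class of `(σ_i(c_i))`. -/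
def IsUltralimitOn {M : S → Type u} [Structure L M] {F : I → ∀ s, Set (M s)}
    (X : ∀ s, Set (Ultrapower U M s)) (σ : ∀ i, AbsGal L (F i))
    (τ : AbsGal L (ultraproduct U F)) : Prop :=
  ∀ (s : S) (x : acl L (ultraproduct U F) s), (x : Ultrapower U M s) ∈ X s →
    ∃ c d : I → M s, (x : Ultrapower U M s) = (c : Ultrapower U M s) ∧
      (τ.act s x : Ultrapower U M s) = (d : Ultrapower U M s) ∧
      ∀ᶠ i in (U : Filter I), ∃ h : c i ∈ acl L (F i) s, ((σ i).act s ⟨c i, h⟩ : M s) = d i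

end Ultra

end ManySorted

end

/-! Put `P = ∏ 𝒢(F_i)`. A sequence of automorphisms acts coordinatewise on the elements of the
ultrapower algebraic over `∏_U F_i`, which gives a homomorphism `l : P → 𝒢(F*)` (`ulim`). Composing
with the `φ_i` gives likewise `k : P → 𝒢(E*)`. The isomorphism `Φ` is the one whose graph is the
closure of the set of pairs `(l σ, k σ)`.

Both images are dense (`exists_ulim_eqOn`). By the Galois correspondence up to closure
(`exists_mem_eqOn_of_fixes`, which rests on canonical parameters of finite sets of tuples), it is
enough that the algebraic elements fixed by all ultralimits lie in the ultraproduct itself. This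
holds because otherwise a moving automorphism could be chosen at almost every coordinate.

The closure is the graph of a bijection because `l` and `k` control each other (`controls_ulim`):
fixing the orbit of an element `y` on one side amounts to fixing a finite set `C` of algebraic
elements of the same sort on the other. This is where sortedness is used. If `y` is the class of
`(d_i)`, the orbits of the `d_i` have size at most some `n`, so their pointwise stabilizers are
open, normal and of index at most `n ^ n`. The fixed points of such a stabilizer are generated by
elements of the sort of `y`, so by sortedness the same holds for its preimage under `φ_i`, and at
most `n ^ n` generators of that sort, with orbits of size at most `n ^ n`, suffice
(`IsSorted.exists_controlling`). The common sort lets the generators form sequences in the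
ultrapower. The uniform bounds make the limit set finite and its elements algebraic
(`mem_acl_ultraproduct`).

The gluing (`exists_sortedIso`) is then formal. Control by finite sets gives existence, uniqueness
and continuity of the limit map; control within one sort gives sortedness. -/

noncomputable section

namespace ManySorted

/-! ### Many-sorted syntax: variables, tuples, renaming and derived connectives -/

section Formulas

variable {S : Type u} {L : Language S} {N : S → Type u} {Γ Δ Λ : List S}

/-- The variables of the first part of a concatenated context. -/
def Var.inl : {Γ Δ : List S} → {s : S} → Var Γ s → Var (Γ ++ Δ) s
  | _ :: _, _, _, .zero => .zero
  | _ :: _, _, _, .succ i => .succ i.inl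

/-- The variables of the second part of a concatenated context. -/
def Var.inr : {Γ Δ : List S} → {s : S} → Var Δ s → Var (Γ ++ Δ) s
  | [], _, _, i => i
  | _ :: _, _, _, i => .succ (Var.inr i)

/-- Precomposition of a tuple with a map of variables. -/
def Tuple.sub (v : Tuple N Δ) (r : Tuple (Var Δ) Γ) : Tuple N Γ := fun s i => v s (r s i)

/-- A renaming is itself a tuple with values in variables, so `Tuple.cons`, `Tuple.append` and
`Tuple.sub` also build renamings, and these lemmas compute their effect on assignments. -/
theorem Tuple.sub_sub (v : Tuple N Λ) (r : Tuple (Var Λ) Δ) (r' : Tuple (Var Δ) Γ) :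
    v.sub (Tuple.sub r r') = (v.sub r).sub r' := rfl

@[simp] theorem Tuple.cons_zero {t : S} (x : N t) (v : Tuple N Γ) :
    Tuple.cons x v t .zero = x := rfl

@[simp] theorem Tuple.cons_succ {t s : S} (x : N t) (v : Tuple N Γ) (i : Var Γ s) :
    Tuple.cons x v s (.succ i) = v s i := rfl

theorem Tuple.eq_nil (v w : Tuple N []) : v = w := by
  funext s i; cases i

theorem Tuple.cons_eta {t : S} (w : Tuple N (t :: Γ)) :
    w = Tuple.cons (w t .zero) (fun s i => w s (.succ i)) := by
  funext s i; cases i <;> rfl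

@[simp] theorem Tuple.sub_cons {t : S} (v : Tuple N Δ) (i : Var Δ t) (r : Tuple (Var Δ) Γ) :
    v.sub (Tuple.cons i r) = Tuple.cons (v t i) (v.sub r) := by
  funext s j; cases j <;> rfl

@[simp] theorem Tuple.append_inl : ∀ {Γ Δ : List S} (u : Tuple N Γ) (v : Tuple N Δ) {s : S}
    (i : Var Γ s), Tuple.append u v s i.inl = u s i
  | _ :: _, _, _, _, _, .zero => rfl
  | _ :: _, _, u, v, _, .succ i => Tuple.append_inl (fun s i => u s (.succ i)) v i

@[simp] theorem Tuple.append_inr : ∀ {Γ Δ : List S} (u : Tuple N Γ) (v : Tuple N Δ) {s : S}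
    (i : Var Δ s), Tuple.append u v s i.inr = v s i
  | [], _, _, _, _, _ => rfl
  | _ :: _, _, u, v, _, i => Tuple.append_inr (fun s i => u s (.succ i)) v i

theorem Var.inl_or_inr : ∀ {Γ Δ : List S} {s : S} (i : Var (Γ ++ Δ) s),
    (∃ j : Var Γ s, i = j.inl) ∨ ∃ j : Var Δ s, i = j.inr
  | [], _, _, i => Or.inr ⟨i, rfl⟩
  | _ :: _, _, _, .zero => Or.inl ⟨.zero, rfl⟩
  | _ :: _, _, _, .succ i => by
    rcases Var.inl_or_inr i with ⟨j, rfl⟩ | ⟨j, rfl⟩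
    · exact Or.inl ⟨.succ j, rfl⟩
    · exact Or.inr ⟨j, rfl⟩

theorem Tuple.append_ext {v w : Tuple N (Γ ++ Δ)} (hl : ∀ s (i : Var Γ s), v s i.inl = w s i.inl)
    (hr : ∀ s (i : Var Δ s), v s i.inr = w s i.inr) : v = w := by
  funext s i
  rcases Var.inl_or_inr i with ⟨j, rfl⟩ | ⟨j, rfl⟩
  · exact hl s j
  · exact hr s j

/-- The inclusion of the first part of a concatenated context. -/
def Tuple.left (Γ Δ : List S) : Tuple (Var (Γ ++ Δ)) Γ := fun _ i => i.inl

/-- The inclusion of the second part of a concatenated context. -/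
def Tuple.right (Γ Δ : List S) : Tuple (Var (Γ ++ Δ)) Δ := fun _ i => i.inr

@[simp] theorem Tuple.append_sub_left (u : Tuple N Γ) (v : Tuple N Δ) :
    (Tuple.append u v).sub (Tuple.left Γ Δ) = u := by
  funext s i; simp [Tuple.sub, Tuple.left]

@[simp] theorem Tuple.append_sub_right (u : Tuple N Γ) (v : Tuple N Δ) :
    (Tuple.append u v).sub (Tuple.right Γ Δ) = v := by
  funext s i; simp [Tuple.sub, Tuple.right]

@[simp] theorem Tuple.sub_append (v : Tuple N Λ) (r : Tuple (Var Λ) Γ) (r' : Tuple (Var Λ) Δ) :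
    v.sub (Tuple.append r r') = Tuple.append (v.sub r) (v.sub r') :=
  Tuple.append_ext (fun s i => by simp [Tuple.sub]) (fun s i => by simp [Tuple.sub])

/-- The inclusion of the tail of a context. -/
def Tuple.tail (t : S) (Γ : List S) : Tuple (Var (t :: Γ)) Γ := fun _ i => .succ i

@[simp] theorem Tuple.cons_sub_tail {t : S} (x : N t) (v : Tuple N Γ) :
    (Tuple.cons x v).sub (Tuple.tail t Γ) = v := rfl

instance Var.finite_sigma : ∀ Γ : List S, Finite (Σ s, Var Γ s)
  | [] => by
    have : IsEmpty (Σ s, Var ([] : List S) s) := ⟨fun x => nomatch x.2⟩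
    infer_instance
  | t :: Γ => by
    have := Var.finite_sigma Γ
    refine Finite.of_surjective
      (fun o : Option (Σ s, Var Γ s) => o.elim (⟨t, .zero⟩ : Σ s, Var (t :: Γ) s)
        (fun p => ⟨p.1, .succ p.2⟩)) ?_
    rintro ⟨s, _ | i⟩
    · exact ⟨none, rfl⟩
    · exact ⟨some ⟨s, i⟩, rfl⟩

instance Var.finite (Γ : List S) (s : S) : Finite (Var Γ s) :=
  Finite.of_injective (fun i => (⟨s, i⟩ : Σ s, Var Γ s)) (fun i j h => by simpa using h)

instance Var.finite_perm (Γ : List S) : Finite (∀ s, Equiv.Perm (Var Γ s)) :=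
  Finite.of_injective
    (fun (r : ∀ s, Equiv.Perm (Var Γ s)) (p : Σ s, Var Γ s) =>
      (⟨p.1, r p.1 p.2⟩ : Σ s, Var Γ s))
    (fun r r' h => by
      funext s; ext i
      simpa using congrFun h ⟨s, i⟩)

/-- Renaming of variables in terms. -/
def Term.rename (r : Tuple (Var Δ) Γ) : {s : S} → Term L Γ s → Term L Δ s
  | _, .var i => .var (r _ i)
  | _, .func f ts => .func f (fun t i => (ts t i).rename r)

/-- Renaming of variables in formulas. -/
def Formula.rename : {Γ Δ : List S} → Tuple (Var Δ) Γ → Formula L Γ → Formula L Δ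
  | _, _, _, .falsum => .falsum
  | _, _, r, .equal t₁ t₂ => .equal (t₁.rename r) (t₂.rename r)
  | _, _, r, .rel R ts => .rel R (fun t i => (ts t i).rename r)
  | _, _, r, .imp φ ψ => .imp (φ.rename r) (ψ.rename r)
  | _, _, r, .all φ => .all (φ.rename (Tuple.cons .zero (fun s i => .succ (r s i))))

variable [Structure L N]

theorem Term.realize_rename (r : Tuple (Var Δ) Γ) (v : Tuple N Δ) {s : S} (t : Term L Γ s) :
    (t.rename r).realize v = t.realize (v.sub r) := by
  induction t with
  | var i => rfl
  | func f ts ih =>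
    simp only [Term.rename, Term.realize]
    congr 1; funext t i; exact ih t i

@[simp] theorem Formula.realize_rename (φ : Formula L Γ) : ∀ {Δ : List S} (r : Tuple (Var Δ) Γ)
    (v : Tuple N Δ), (φ.rename r).Realize v ↔ φ.Realize (v.sub r) := by
  induction φ with
  | falsum => intros; rfl
  | equal t₁ t₂ => intros; simp only [Formula.rename, Formula.Realize, Term.realize_rename]
  | rel R ts => intros; simp only [Formula.rename, Formula.Realize, Term.realize_rename]
  | imp φ ψ ihφ ihψ => intros; simp only [Formula.rename, Formula.Realize, ihφ, ihψ]
  | all φ ih =>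
    intro Δ r v
    simp only [Formula.rename, Formula.Realize, ih, Tuple.sub_cons]
    rfl

/-- Negation. -/
def Formula.neg (φ : Formula L Γ) : Formula L Γ := .imp φ .falsum
/-- Conjunction. -/
def Formula.and (φ ψ : Formula L Γ) : Formula L Γ := .neg (.imp φ (.neg ψ))
/-- Disjunction. -/
def Formula.or (φ ψ : Formula L Γ) : Formula L Γ := .imp (.neg φ) ψ
/-- Equivalence. -/
def Formula.iff (φ ψ : Formula L Γ) : Formula L Γ := .and (.imp φ ψ) (.imp ψ φ)
/-- Existential quantification. -/
def Formula.ex {s : S} (φ : Formula L (s :: Γ)) : Formula L Γ := .neg (.all (.neg φ))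
/-- Universal quantification over a tuple. -/
def Formula.allT : (Λ : List S) → Formula L (Λ ++ Γ) → Formula L Γ
  | [], φ => φ
  | _ :: Λ, φ => Formula.allT Λ (.all φ)
/-- Existential quantification over a tuple. -/
def Formula.exT (Λ : List S) (φ : Formula L (Λ ++ Γ)) : Formula L Γ := .neg (.allT Λ (.neg φ))
/-- Equality of two variables. -/
def Formula.varEq {s : S} (i j : Var Γ s) : Formula L Γ := .equal (.var i) (.var j)

section
variable {v : Tuple N Γ} {φ ψ : Formula L Γ}

theorem Formula.realize_imp : (Formula.imp φ ψ).Realize v ↔ (φ.Realize v → ψ.Realize v) := Iff.rfl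

@[simp] theorem Formula.realize_neg : φ.neg.Realize v ↔ ¬ φ.Realize v := Iff.rfl

@[simp] theorem Formula.realize_and : (φ.and ψ).Realize v ↔ φ.Realize v ∧ ψ.Realize v := by
  show ((φ.Realize v → ψ.Realize v → False) → False) ↔ _
  tauto

@[simp] theorem Formula.realize_or : (φ.or ψ).Realize v ↔ φ.Realize v ∨ ψ.Realize v := by
  show ((φ.Realize v → False) → ψ.Realize v) ↔ _
  tauto

@[simp] theorem Formula.realize_iff : (φ.iff ψ).Realize v ↔ (φ.Realize v ↔ ψ.Realize v) := by
  simp only [Formula.iff, Formula.realize_and, Formula.realize_imp, iff_def]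

theorem Formula.realize_all {s : S} {φ : Formula L (s :: Γ)} :
    (Formula.all φ).Realize v ↔ ∀ x : N s, φ.Realize (Tuple.cons x v) := Iff.rfl

@[simp] theorem Formula.realize_ex {s : S} {φ : Formula L (s :: Γ)} :
    φ.ex.Realize v ↔ ∃ x : N s, φ.Realize (Tuple.cons x v) := by
  simp only [Formula.ex, Formula.realize_neg, Formula.realize_all, not_forall, not_not]

@[simp] theorem Formula.realize_allT : ∀ {Λ : List S} {φ : Formula L (Λ ++ Γ)},
    (Formula.allT Λ φ).Realize v ↔ ∀ u : Tuple N Λ, φ.Realize (Tuple.append u v)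
  | [], φ => ⟨fun h _ => h, fun h => h Tuple.nil⟩
  | s :: Λ, φ => by
    rw [Formula.allT, Formula.realize_allT]
    constructor
    · intro h u
      exact h (fun s i => u s (.succ i)) (u s .zero)
    · intro h u x
      exact h (Tuple.cons x u)

@[simp] theorem Formula.realize_exT {Λ : List S} {φ : Formula L (Λ ++ Γ)} :
    (Formula.exT Λ φ).Realize v ↔ ∃ u : Tuple N Λ, φ.Realize (Tuple.append u v) := by
  simp only [Formula.exT, Formula.realize_neg, Formula.realize_allT, not_forall, not_not]

@[simp] theorem Formula.realize_varEq {s : S} {i j : Var Γ s} :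
    (Formula.varEq i j : Formula L Γ).Realize v ↔ v s i = v s j := Iff.rfl

end

/-- The formula is chosen before the structure, so that the same one can be read both in `M` and in
its ultrapower. -/
theorem Formula.exists_iSup {ι : Type*} [Finite ι] (φ : ι → Formula L Γ) :
    ∃ ψ : Formula L Γ, ∀ (N : S → Type u) [Structure L N] (v : Tuple N Γ),
      ψ.Realize v ↔ ∃ i, (φ i).Realize v := by
  have := Fintype.ofFinite ι
  suffices h : ∀ l : List ι, ∃ ψ : Formula L Γ, ∀ (N : S → Type u) [Structure L N] (v : Tuple N Γ),
      ψ.Realize v ↔ ∃ i ∈ l, (φ i).Realize v by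
    obtain ⟨ψ, hψ⟩ := h Finset.univ.toList
    exact ⟨ψ, fun N _ v => by simpa using hψ N v⟩
  intro l
  induction l with
  | nil => exact ⟨.falsum, fun N _ v => by simp [Formula.Realize]⟩
  | cons a l ih =>
    obtain ⟨ψ, hψ⟩ := ih
    exact ⟨(φ a).or ψ, fun N _ v => by simp [hψ]⟩

theorem Formula.exists_iInf {ι : Type*} [Finite ι] (φ : ι → Formula L Γ) :
    ∃ ψ : Formula L Γ, ∀ (N : S → Type u) [Structure L N] (v : Tuple N Γ),
      ψ.Realize v ↔ ∀ i, (φ i).Realize v := by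
  obtain ⟨ψ, hψ⟩ := Formula.exists_iSup (fun i => (φ i).neg)
  exact ⟨ψ.neg, fun N _ v => by simp [hψ]⟩

/-- Equality of two tuples of variables is expressible. -/
theorem Formula.exists_tupleEq (r r' : Tuple (Var Δ) Γ) :
    ∃ ψ : Formula L Δ, ∀ (N : S → Type u) [Structure L N] (v : Tuple N Δ),
      ψ.Realize v ↔ v.sub r = v.sub r' := by
  obtain ⟨ψ, hψ⟩ := Formula.exists_iInf (L := L)
    (fun p : Σ s, Var Γ s => Formula.varEq (r p.1 p.2) (r' p.1 p.2))
  refine ⟨ψ, fun N _ v => ?_⟩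
  rw [hψ]
  constructor
  · intro h; funext s i; exact h ⟨s, i⟩
  · intro h p; exact congrFun (congrFun h p.1) p.2

end Formulas

/-! ### Łoś's theorem for many-sorted ultrapowers -/

section Los

variable {S : Type u} {L : Language S} {I : Type u} (U : Ultrafilter I)

/-- The tuple of classes of a sequence of tuples. -/
def ultraTuple {M : S → Type u} {Γ : List S} (w : I → Tuple M Γ) : Tuple (Ultrapower U M) Γ :=
  fun s j => ((fun i => w i s j : I → M s) : Ultrapower U M s)

theorem exists_ultraTuple {M : S → Type u} {Γ : List S} (v : Tuple (Ultrapower U M) Γ) :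
    ∃ w : I → Tuple M Γ, ultraTuple U w = v :=
  ⟨fun i s j => Ultrapower.rep U (v s j) i, by
    funext s j; exact Ultrapower.coe_rep U (v s j)⟩

theorem exists_coe {M : S → Type u} {s : S} (x : Ultrapower U M s) :
    ∃ a : I → M s, (a : Ultrapower U M s) = x := ⟨_, Ultrapower.coe_rep U x⟩

theorem exists_seq {α : I → Type*} [∀ i, Nonempty (α i)] {P : ∀ i, α i → Prop}
    (h : ∀ᶠ i in (U : Filter I), ∃ x, P i x) :
    ∃ a : ∀ i, α i, ∀ᶠ i in (U : Filter I), P i (a i) := by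
  classical
  refine ⟨fun i => if h : ∃ x, P i x then h.choose else Classical.arbitrary _, ?_⟩
  filter_upwards [h] with i hi
  rw [dif_pos hi]; exact hi.choose_spec

theorem exists_seq_const {α : Type*} {P : I → α → Prop}
    (h : ∀ᶠ i in (U : Filter I), ∃ x, P i x) :
    ∃ a : I → α, ∀ᶠ i in (U : Filter I), P i (a i) := by
  obtain ⟨_, x, _⟩ := h.exists
  have : Nonempty α := ⟨x⟩
  exact exists_seq U (α := fun _ => α) h

theorem eventually_tuple_eq {M : S → Type u} {Γ : List S} {w w' : I → Tuple M Γ}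
    (h : ultraTuple U w = ultraTuple U w') : ∀ᶠ i in (U : Filter I), w i = w' i := by
  have : ∀ p : Σ s, Var Γ s, ∀ᶠ i in (U : Filter I), w i p.1 p.2 = w' i p.1 p.2 := fun p =>
    Filter.Germ.coe_eq.1 (congrFun (congrFun h p.1) p.2)
  filter_upwards [Filter.eventually_all.2 this] with i hi
  funext s j; exact hi ⟨s, j⟩

-- The symbols of the ultrapower are interpreted through chosen representatives; since these agree
-- almost everywhere with any others, the interpretation can be computed on arbitrary ones.
variable {U} in
theorem eventually_rep_eq {M : S → Type u} {Γ : List S} (w : I → Tuple M Γ) :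
    ∀ᶠ i in (U : Filter I), (fun s j => Ultrapower.rep U (ultraTuple U w s j) i) = w i := by
  refine eventually_tuple_eq U ?_
  funext s j; exact Ultrapower.coe_rep U _

theorem ultraTuple_cons {M : S → Type u} {Γ : List S} {s : S} (a : I → M s) (w : I → Tuple M Γ) :
    ultraTuple U (fun i => Tuple.cons (a i) (w i)) =
      Tuple.cons (M := Ultrapower U M) (a : Ultrapower U M s) (ultraTuple U w) := by
  funext s j; cases j <;> rfl

theorem ultraTuple_append {M : S → Type u} {Γ Δ : List S} (a : I → Tuple M Γ)
    (w : I → Tuple M Δ) :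
    ultraTuple U (fun i => Tuple.append (a i) (w i)) =
      Tuple.append (ultraTuple U a) (ultraTuple U w) :=
  Tuple.append_ext (fun s i => by simp [ultraTuple]) (fun s i => by simp [ultraTuple])

variable {M : S → Type u} [Structure L M]

theorem Term.realize_ultraTuple {Γ : List S} (w : I → Tuple M Γ) {s : S} (t : Term L Γ s) :
    t.realize (ultraTuple U w) = ((fun i => t.realize (w i) : I → M s) : Ultrapower U M s) := by
  induction t with
  | var i => rfl
  | func f ts ih =>
    have h : (fun t i => (ts t i).realize (ultraTuple U w)) =
        ultraTuple U (fun k t i => (ts t i).realize (w k)) := by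
      funext t i; exact ih t i
    simp only [Term.realize, h]
    refine Filter.Germ.coe_eq.2 ?_
    filter_upwards [eventually_rep_eq (U := U) (fun k t i => (ts t i).realize (w k))] with i hi
    exact congrArg _ hi

/-- **Łoś's theorem**. -/
theorem Formula.realize_ultraTuple {Γ : List S} (φ : Formula L Γ) : ∀ w : I → Tuple M Γ,
    φ.Realize (ultraTuple U w) ↔ ∀ᶠ i in (U : Filter I), φ.Realize (w i) := by
  induction φ with
  | falsum => intro w; simp [Formula.Realize, U.neBot.ne]
  | equal t₁ t₂ =>
    intro w
    simp only [Formula.Realize, Term.realize_ultraTuple]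
    exact Filter.Germ.coe_eq
  | rel R ts =>
    intro w
    have h : (fun t i => (ts t i).realize (ultraTuple U w)) =
        ultraTuple U (fun k t i => (ts t i).realize (w k)) := by
      funext t i; exact Term.realize_ultraTuple U w _
    simp only [Formula.Realize, h]
    refine Filter.eventually_congr ?_
    filter_upwards [eventually_rep_eq (U := U) (fun k t i => (ts t i).realize (w k))] with i hi
    exact iff_of_eq (congrArg _ hi)
  | imp φ ψ ihφ ihψ =>
    intro w
    simp only [Formula.Realize, ihφ, ihψ]
    exact Ultrafilter.eventually_imp.symm
  | @all Γ s φ ih =>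
    intro w
    simp only [Formula.realize_all]
    constructor
    · intro h
      by_contra hn
      rw [← Ultrafilter.eventually_not] at hn
      simp only [not_forall] at hn
      obtain ⟨a, ha⟩ := exists_seq_const U hn
      have := h (a : Ultrapower U M s)
      rw [← ultraTuple_cons, ih] at this
      obtain ⟨i, h₁, h₂⟩ := (ha.and this).exists
      exact h₁ h₂
    · intro h x
      obtain ⟨a, rfl⟩ := exists_coe U x
      rw [← ultraTuple_cons, ih]
      exact h.mono fun i hi => hi _

theorem Theory.IsModel.ultrapower {T : Theory L} (hM : T.IsModel M) :
    T.IsModel (Ultrapower U M) := by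
  intro φ hφ
  have := (Formula.realize_ultraTuple (M := M) U φ (fun _ => Tuple.nil)).2
    (Filter.Eventually.of_forall fun _ => hM φ hφ)
  rwa [Tuple.eq_nil (ultraTuple U _) Tuple.nil] at this

end Los

/-! ### Definable and algebraic closure -/

section Closure

variable {S : Type u} {L : Language S} {N : S → Type u} [Structure L N] {A B : ∀ s, Set (N s)}

theorem dcl_mono (h : ∀ s, A s ⊆ B s) (s : S) : dcl L A s ⊆ dcl L B s := by
  rintro x ⟨Δ, φ, b, hb, hx⟩
  exact ⟨Δ, φ, b, fun t i => h t (hb t i), hx⟩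

theorem acl_mono (h : ∀ s, A s ⊆ B s) (s : S) : acl L A s ⊆ acl L B s := by
  rintro x ⟨Δ, φ, b, hb, hx⟩
  exact ⟨Δ, φ, b, fun t i => h t (hb t i), hx⟩

theorem dcl_subset_acl (s : S) : dcl L A s ⊆ acl L A s := by
  rintro x ⟨Δ, φ, b, hb, hx⟩
  refine ⟨Δ, φ, b, hb, (hx x).2 rfl, ?_⟩
  simp only [hx]
  exact Set.finite_singleton x

theorem subset_dcl (s : S) : A s ⊆ dcl L A s := by
  intro x hx
  refine ⟨[s], Formula.varEq .zero (.succ .zero), Tuple.cons x Tuple.nil, ?_, fun y => ?_⟩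
  · rintro t (_ | i)
    · exact hx
    · cases i
  · exact Iff.rfl

theorem subset_acl (s : S) : A s ⊆ acl L A s := (subset_dcl s).trans (dcl_subset_acl s)

/-- The formula defining the projection of a definable set of tuples to one coordinate. -/
def Formula.proj {Γ Δ : List S} {s : S} (χ : Formula L (Γ ++ Δ)) (i : Var Γ s) :
    Formula L (s :: Δ) :=
  .exT Γ (.and (χ.rename (Tuple.append (Tuple.left Γ (s :: Δ))
      ((Tuple.right Γ (s :: Δ)).sub (Tuple.tail s Δ))))
    (.varEq (Var.inr .zero) (Var.inl i)))

theorem Formula.realize_proj {Γ Δ : List S} {s : S} (χ : Formula L (Γ ++ Δ)) (i : Var Γ s)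
    (x : N s) (b : Tuple N Δ) :
    (χ.proj i).Realize (Tuple.cons x b) ↔
      ∃ e : Tuple N Γ, χ.Realize (Tuple.append e b) ∧ x = e s i := by
  simp [Formula.proj, Tuple.sub_sub]

theorem mem_acl_of_tuple {Γ Δ : List S} (χ : Formula L (Γ ++ Δ)) {e : Tuple N Γ} {b : Tuple N Δ}
    (hb : ∀ t i, b t i ∈ A t) (he : χ.Realize (Tuple.append e b))
    (hfin : {e : Tuple N Γ | χ.Realize (Tuple.append e b)}.Finite) (s : S) (i : Var Γ s) :
    e s i ∈ acl L A s := by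
  refine ⟨Δ, χ.proj i, b, hb, (Formula.realize_proj _ _ _ _).2 ⟨e, he, rfl⟩, ?_⟩
  refine (hfin.image (fun e => e s i)).subset ?_
  rintro y hy
  obtain ⟨e', he', rfl⟩ := (Formula.realize_proj _ _ _ _).1 hy
  exact ⟨e', he', rfl⟩

theorem mem_dcl_of_tuple {Γ Δ : List S} (χ : Formula L (Γ ++ Δ)) {e : Tuple N Γ} {b : Tuple N Δ}
    (hb : ∀ t i, b t i ∈ A t) (he : ∀ e', χ.Realize (Tuple.append e' b) ↔ e' = e)
    (s : S) (i : Var Γ s) : e s i ∈ dcl L A s := by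
  refine ⟨Δ, χ.proj i, b, hb, fun y => ?_⟩
  simp [Formula.realize_proj, he]

theorem exists_formula_of_mem_acl : ∀ {Γ : List S} {e : Tuple N Γ}, (∀ s i, e s i ∈ acl L A s) →
    ∃ (Δ : List S) (χ : Formula L (Γ ++ Δ)) (b : Tuple N Δ), (∀ t i, b t i ∈ A t) ∧
      χ.Realize (Tuple.append e b) ∧ {e : Tuple N Γ | χ.Realize (Tuple.append e b)}.Finite
  | [], e, _ => by
    refine ⟨[], .neg .falsum, Tuple.nil, ?_, id,
      Set.Finite.subset (Set.finite_singleton e) fun v _ => Tuple.eq_nil v e⟩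
    rintro _ ⟨⟩
  | s :: Γ, e, he => by
    obtain ⟨Δ, χ, b, hb, hχ, hfin⟩ := exists_formula_of_mem_acl (Γ := Γ)
      (e := fun s i => e s (.succ i)) (fun s i => he s (.succ i))
    obtain ⟨Δ₀, φ, b₀, hb₀, hφ, hfin₀⟩ := he s .zero
    refine ⟨Δ₀ ++ Δ, .and
      (φ.rename (Tuple.cons (Tuple.left (s :: Γ) (Δ₀ ++ Δ) s .zero)
        ((Tuple.right (s :: Γ) (Δ₀ ++ Δ)).sub (Tuple.left Δ₀ Δ))))
      (χ.rename (Tuple.append ((Tuple.left (s :: Γ) (Δ₀ ++ Δ)).sub (Tuple.tail s Γ))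
        ((Tuple.right (s :: Γ) (Δ₀ ++ Δ)).sub (Tuple.right Δ₀ Δ)))),
      Tuple.append b₀ b, ?_, ?_, ?_⟩
    · intro t i
      rcases Var.inl_or_inr i with ⟨j, rfl⟩ | ⟨j, rfl⟩
      · simpa using hb₀ t j
      · simpa using hb t j
    · simp only [Formula.realize_and, Formula.realize_rename, Tuple.sub_cons, Tuple.sub_sub,
        Tuple.sub_append, Tuple.append_sub_left, Tuple.append_sub_right, Tuple.left,
        Tuple.append_inl]
      exact ⟨hφ, hχ⟩
    · refine ((hfin₀.prod hfin).image (fun p => Tuple.cons p.1 p.2)).subset ?_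
      intro w hw
      simp only [Set.mem_ofPred_eq, Formula.realize_and, Formula.realize_rename, Tuple.sub_cons,
        Tuple.sub_sub, Tuple.sub_append, Tuple.append_sub_left, Tuple.append_sub_right, Tuple.left,
        Tuple.append_inl] at hw
      exact ⟨(w s .zero, fun s i => w s (.succ i)), hw, (Tuple.cons_eta w).symm⟩

/-- The algebraic parameters range over a finite set defined by `χ`. Keeping only those parameters
over which `φ` has exactly one solution, and adding that solution as a coordinate, gives a finite
set of tuples definable over `A`. -/
theorem dcl_acl_subset (s : S) : dcl L (acl L A) s ⊆ acl L A s := by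
  rintro x ⟨Γ, φ, e, he, hx⟩
  obtain ⟨Δ, χ, b, hb, hχ, hfin⟩ := exists_formula_of_mem_acl he
  have hφ : ∀ (w : Tuple N (s :: Γ)) (b : Tuple N Δ),
      (Formula.and (χ.rename (Tuple.append ((Tuple.left (s :: Γ) Δ).sub (Tuple.tail s Γ))
          (Tuple.right (s :: Γ) Δ)))
        (.and (φ.rename (Tuple.left (s :: Γ) Δ))
        (.all (.imp (φ.rename (Tuple.cons .zero
            ((Tuple.tail s (s :: Γ ++ Δ)).sub ((Tuple.left (s :: Γ) Δ).sub (Tuple.tail s Γ)))))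
          (.varEq .zero (.succ (Tuple.left (s :: Γ) Δ s .zero))))))).Realize (Tuple.append w b) ↔
      χ.Realize (Tuple.append (w.sub (Tuple.tail s Γ)) b) ∧ φ.Realize w ∧
        ∀ x, φ.Realize (Tuple.cons x (w.sub (Tuple.tail s Γ))) → x = w s .zero := by
    intro w b
    simp only [Formula.realize_and, Formula.realize_all, Formula.realize_imp,
      Formula.realize_rename, Formula.realize_varEq, Tuple.sub_cons,
        Tuple.sub_sub, Tuple.sub_append, Tuple.append_sub_left, Tuple.append_sub_right,
        Tuple.cons_sub_tail, Tuple.cons_zero, Tuple.cons_succ]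
    simp only [Tuple.left, Tuple.append_inl]
  refine mem_acl_of_tuple (e := Tuple.cons x e) _ hb
    ((hφ _ _).2 ⟨hχ, (hx x).2 rfl, fun y hy => (hx y).1 hy⟩) ?_ s .zero
  simp only [hφ]
  -- Forgetting the first coordinate is injective on this set, since that coordinate is the only
  -- solution of `φ` over the others.
  refine Set.Finite.of_finite_image (f := fun w => w.sub (Tuple.tail s Γ)) (hfin.subset ?_) ?_
  · rintro _ ⟨w, hw, rfl⟩
    exact hw.1
  · intro w hw w' hw' h
    simp only at h
    rw [Tuple.cons_eta w, Tuple.cons_eta w']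
    congr 1
    refine hw'.2.2 _ ?_
    rw [← h]
    have := hw.2.1
    rwa [Tuple.cons_eta w] at this

theorem funMap_mem_dcl {Δ : List S} {s : S} (f : L.Functions Δ s) (v : Tuple N Δ)
    (hv : ∀ t i, v t i ∈ A t) : Structure.funMap f v ∈ dcl L A s := by
  refine ⟨Δ, .equal (.var .zero) (.func f (fun t i => .var (.succ i))), v, hv, fun y => ?_⟩
  exact Iff.rfl

end Closure

/-! ### Elementary relations and their extension to algebraic elements -/

section Elementary

variable {S : Type u} {L : Language S} {N : S → Type u} [Structure L N] {A B : ∀ s, Set (N s)}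

variable (L) in
/-- A relation is elementary if it transfers the satisfaction of formulas. -/
def IsElementary (R : Set (Σ s, N s × N s)) : Prop :=
  ∀ (Γ : List S) (u v : Tuple N Γ), (∀ s i, ⟨s, u s i, v s i⟩ ∈ R) →
    ∀ φ : Formula L Γ, φ.Realize u → φ.Realize v

theorem IsElementary.iff {R : Set (Σ s, N s × N s)} (hR : IsElementary L R) {Γ : List S}
    {u v : Tuple N Γ} (h : ∀ s i, ⟨s, u s i, v s i⟩ ∈ R) (φ : Formula L Γ) :
    φ.Realize u ↔ φ.Realize v :=
  ⟨hR Γ u v h φ, fun hv => by_contra fun hu => hR Γ u v h φ.neg hu hv⟩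

theorem IsElementary.symm {R : Set (Σ s, N s × N s)} (hR : IsElementary L R) :
    IsElementary L {p : Σ s, N s × N s | (⟨p.1, p.2.2, p.2.1⟩ : Σ s, N s × N s) ∈ R} :=
  fun _ _ _ h φ => (hR.iff h φ).2

/-- Applied to equality, elementarity makes the relation the graph of an injective partial map. -/
theorem IsElementary.eq_iff {R : Set (Σ s, N s × N s)} (hR : IsElementary L R) {s : S}
    {x x' y y' : N s} (h : ⟨s, x, y⟩ ∈ R) (h' : ⟨s, x', y'⟩ ∈ R) : x = x' ↔ y = y' := by
  refine hR.iff (u := Tuple.cons x (Tuple.cons x' Tuple.nil))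
    (v := Tuple.cons y (Tuple.cons y' Tuple.nil)) ?_ (Formula.varEq .zero (.succ .zero))
  rintro t (_ | _ | i)
  · exact h
  · exact h'
  · cases i

/-- An algebraic element satisfies a formula isolating its type. -/
theorem exists_isolating {s : S} {x : N s} (hx : x ∈ acl L B s) :
    ∃ (Δ : List S) (φ : Formula L (s :: Δ)) (b : Tuple N Δ), (∀ t i, b t i ∈ B t) ∧
      φ.Realize (Tuple.cons x b) ∧ ∀ (Δ' : List S) (ψ : Formula L (s :: Δ')) (b' : Tuple N Δ'),
        (∀ t i, b' t i ∈ B t) → ψ.Realize (Tuple.cons x b') →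
        ∀ y, φ.Realize (Tuple.cons y b) → ψ.Realize (Tuple.cons y b') := by
  classical
  -- Among the formulas over `B` satisfied by `x` with finitely many solutions, one with the fewest
  -- isolates the type: conjoining `ψ` cannot discard a solution.
  have hex : ∃ n, ∃ (Δ : List S) (φ : Formula L (s :: Δ)) (b : Tuple N Δ), (∀ t i, b t i ∈ B t) ∧
      φ.Realize (Tuple.cons x b) ∧ {y | φ.Realize (Tuple.cons y b)}.Finite ∧
      {y | φ.Realize (Tuple.cons y b)}.ncard = n := by
    obtain ⟨Δ, φ, b, hb, hφ, hfin⟩ := hx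
    exact ⟨_, Δ, φ, b, hb, hφ, hfin, rfl⟩
  obtain ⟨Δ, φ, b, hb, hφ, hfin, hn⟩ := Nat.find_spec hex
  refine ⟨Δ, φ, b, hb, hφ, fun Δ' ψ b' hb' hψ y hy => ?_⟩
  have key : ∀ z, (Formula.and (φ.rename (Tuple.cons .zero
      ((Tuple.tail s (Δ ++ Δ')).sub (Tuple.left Δ Δ')))) (ψ.rename (Tuple.cons .zero
      ((Tuple.tail s (Δ ++ Δ')).sub (Tuple.right Δ Δ'))))).Realize
        (Tuple.cons z (Tuple.append b b')) ↔
      φ.Realize (Tuple.cons z b) ∧ ψ.Realize (Tuple.cons z b') := by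
    intro z
    simp [Tuple.sub_sub]
  have hsub : {y | φ.Realize (Tuple.cons y b) ∧ ψ.Realize (Tuple.cons y b')} ⊆
      {y | φ.Realize (Tuple.cons y b)} := fun z hz => hz.1
  have hle := Nat.find_min' hex ⟨Δ ++ Δ', _, Tuple.append b b', fun t i => by
      rcases Var.inl_or_inr i with ⟨j, rfl⟩ | ⟨j, rfl⟩
      · simpa using hb t j
      · simpa using hb' t j, (key x).2 ⟨hφ, hψ⟩, by
        simp only [key]; exact hfin.subset hsub, rfl⟩
  simp only [key] at hle
  rw [← hn] at hle
  have := Set.eq_of_subset_of_ncard_le hsub hle hfin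
  exact (this.symm ▸ hy : y ∈ {y | φ.Realize (Tuple.cons y b) ∧ ψ.Realize (Tuple.cons y b')}).2

/-- Normal form for tuples over the enlarged relation: every occurrence of the new pair is collected
in one variable, and what remains is related by `R`. -/
theorem exists_sub_cons {R : Set (Σ s, N s × N s)} {s : S} (x y : N s) :
    ∀ {Γ : List S} (u v : Tuple N Γ),
      (∀ t i, (⟨t, u t i, v t i⟩ : Σ s, N s × N s) ∈ insert ⟨s, x, y⟩ R) →
      ∃ (Γ' : List S) (r : Tuple (Var (s :: Γ')) Γ) (u' v' : Tuple N Γ'),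
        (∀ t i, ⟨t, u' t i, v' t i⟩ ∈ R) ∧ u = (Tuple.cons x u').sub r ∧
        v = (Tuple.cons y v').sub r
  | [], u, v, _ => ⟨[], fun _ i => (nomatch i), Tuple.nil, Tuple.nil, fun _ i => (nomatch i),
      Tuple.eq_nil _ _, Tuple.eq_nil _ _⟩
  | t :: Γ, u, v, h => by
    obtain ⟨Γ', r, u', v', h', hu, hv⟩ := exists_sub_cons (R := R) x y
      (fun s i => u s (.succ i)) (fun s i => v s (.succ i)) (fun s i => h s (.succ i))
    rcases h t .zero with heq | hR
    · obtain rfl : t = s := congrArg Sigma.fst heq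
      simp only [Sigma.mk.injEq, heq_eq_eq, Prod.mk.injEq, true_and] at heq
      refine ⟨Γ', Tuple.cons .zero r, u', v', h', ?_, ?_⟩
      · rw [Tuple.sub_cons, ← hu, Tuple.cons_zero, ← heq.1, ← Tuple.cons_eta]
      · rw [Tuple.sub_cons, ← hv, Tuple.cons_zero, ← heq.2, ← Tuple.cons_eta]
    · refine ⟨t :: Γ', Tuple.cons (.succ .zero) ((Tuple.cons (M := Var (s :: t :: Γ')) .zero
        ((Tuple.tail s (t :: Γ')).sub (Tuple.tail t Γ'))).sub r),
        Tuple.cons (u t .zero) u', Tuple.cons (v t .zero) v', ?_, ?_, ?_⟩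
      · rintro a (_ | i)
        · exact hR
        · exact h' a i
      · rw [Tuple.sub_cons, Tuple.sub_sub, Tuple.sub_cons, Tuple.sub_sub, Tuple.cons_sub_tail,
          Tuple.cons_sub_tail, Tuple.cons_zero, Tuple.cons_succ, Tuple.cons_zero, ← hu,
          ← Tuple.cons_eta]
      · rw [Tuple.sub_cons, Tuple.sub_sub, Tuple.sub_cons, Tuple.sub_sub, Tuple.cons_sub_tail,
          Tuple.cons_sub_tail, Tuple.cons_zero, Tuple.cons_succ, Tuple.cons_zero, ← hv,
          ← Tuple.cons_eta]

/-- If `y` satisfies the image of a formula isolating the type of `x` over the domain of an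
elementary relation, then `(x, y)` can be added to the relation. -/
theorem IsElementary.adjoin {R : Set (Σ s, N s × N s)} (hR : IsElementary L R) {s : S}
    {x y : N s} {Δ : List S} {φ : Formula L (s :: Δ)} {b c : Tuple N Δ}
    (hbc : ∀ t i, ⟨t, b t i, c t i⟩ ∈ R) (hy : φ.Realize (Tuple.cons y c))
    (hφ : ∀ (Δ' : List S) (ψ : Formula L (s :: Δ')) (b' : Tuple N Δ'),
        (∀ t i, ∃ z, ⟨t, b' t i, z⟩ ∈ R) → ψ.Realize (Tuple.cons x b') →
        ∀ y, φ.Realize (Tuple.cons y b) → ψ.Realize (Tuple.cons y b')) :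
    IsElementary L (insert ⟨s, x, y⟩ R) := by
  intro Γ u v h χ hu
  obtain ⟨Γ', r, u', v', h', rfl, rfl⟩ := exists_sub_cons x y u v h
  rw [← Formula.realize_rename] at hu ⊢
  have h₁ := hφ Γ' _ u' (fun t i => ⟨_, h' t i⟩) hu
  -- The implication from `φ(x, b)` to `χ` is a universally quantified formula about `b` and `u'`
  -- alone, so `R` transports it to `c` and `v'`.
  have h₂ := (hR.iff (u := Tuple.append b u') (v := Tuple.append c v') (fun t i => by
      rcases Var.inl_or_inr i with ⟨j, rfl⟩ | ⟨j, rfl⟩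
      · simpa using hbc t j
      · simpa using h' t j)
    (Formula.all (.imp (φ.rename (Tuple.cons .zero
      ((Tuple.tail s (Δ ++ Γ')).sub (Tuple.left Δ Γ')))) ((χ.rename r).rename (Tuple.cons .zero
      ((Tuple.tail s (Δ ++ Γ')).sub (Tuple.right Δ Γ'))))))).1
  simp only [Formula.realize_all, Formula.realize_imp, Formula.realize_rename, Tuple.sub_cons,
    Tuple.sub_sub, Tuple.cons_zero, Tuple.cons_sub_tail, Tuple.append_sub_left,
    Tuple.append_sub_right] at h₂ h₁ ⊢
  exact h₂ h₁ y hy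

/-- Extension step without saturation: the type of an algebraic element over the domain of `R` is
isolated, so realizing its image only requires transporting one existential formula. -/
theorem IsElementary.exists_adjoin {R : Set (Σ s, N s × N s)} (hR : IsElementary L R)
    (hA : ∀ s, ∀ a ∈ A s, ∃ z, ⟨s, a, z⟩ ∈ R) {s : S} {x : N s} (hx : x ∈ acl L A s) :
    ∃ y, IsElementary L (insert ⟨s, x, y⟩ R) := by
  obtain ⟨Δ, φ, b, hb, hφ, hiso⟩ := exists_isolating (B := fun s => {a | ∃ z, ⟨s, a, z⟩ ∈ R})
    (acl_mono hA s hx)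
  choose c hc using hb
  have := (hR.iff hc φ.ex).1 (Formula.realize_ex.2 ⟨x, hφ⟩)
  obtain ⟨y, hy⟩ := Formula.realize_ex.1 this
  exact ⟨y, hR.adjoin hc hy hiso⟩

theorem IsElementary.mem_acl {R : Set (Σ s, N s × N s)} (hR : IsElementary L R)
    (hA : ∀ s, ∀ a ∈ A s, ⟨s, a, a⟩ ∈ R) {s : S} {x y : N s} (hx : x ∈ acl L A s)
    (h : ⟨s, x, y⟩ ∈ R) : y ∈ acl L A s := by
  obtain ⟨Δ, φ, b, hb, hφ, hfin⟩ := hx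
  refine ⟨Δ, φ, b, hb, hR _ _ _ ?_ φ hφ, hfin⟩
  rintro t (_ | i)
  · exact h
  · exact hA _ _ (hb _ _)

theorem IsElementary.mem_iff_of_formula {R : Set (Σ s, N s × N s)} (hR : IsElementary L R)
    (hA : ∀ s, ∀ a ∈ A s, ⟨s, a, a⟩ ∈ R) {s : S} {x y : N s} (h : ⟨s, x, y⟩ ∈ R)
    {Δ : List S} (φ : Formula L (s :: Δ)) {b : Tuple N Δ} (hb : ∀ t i, b t i ∈ A t) :
    φ.Realize (Tuple.cons x b) ↔ φ.Realize (Tuple.cons y b) := by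
  refine hR.iff ?_ φ
  rintro t (_ | i)
  · exact h
  · exact hA _ _ (hb _ _)

theorem IsElementary.sUnion {c : Set (Set (Σ s, N s × N s))} (hc : ∀ R ∈ c, IsElementary L R)
    (hchain : IsChain (· ⊆ ·) c) (hne : c.Nonempty) : IsElementary L (⋃₀ c) := by
  intro Γ u v h
  obtain ⟨R, hR, hsub⟩ := hchain.directedOn.exists_mem_subset_of_finite_of_subset_sUnion hne
    (Set.finite_range fun p : Σ s, Var Γ s => (⟨p.1, u p.1 p.2, v p.1 p.2⟩ : Σ s, N s × N s))
    (by rintro _ ⟨p, rfl⟩; exact h p.1 p.2)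
  exact hc R hR Γ u v fun s i => hsub ⟨⟨s, i⟩, rfl⟩

end Elementary

/-! ### The action of the Galois group, and extension of partial automorphisms -/

section GaloisAction

variable {S : Type u} {L : Language S} {N : S → Type u} [Structure L N] {A B : ∀ s, Set (N s)}

open Classical in
/-- The action of `𝒢(A)` on `acl(A)`, extended by the identity outside `acl(A)`. -/
def AbsGal.ext (s : S) : AbsGal L A →* Equiv.Perm (N s) :=
  (Equiv.Perm.ofSubtype (p := (· ∈ acl L A s))).comp
    ((Pi.evalMonoidHom (fun s => Equiv.Perm (acl L A s)) s).comp
      (autGroup L (acl L A) (dcl L A)).subtype)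

namespace AbsGal

theorem ext_of_mem (σ : AbsGal L A) {s : S} {x : N s} (h : x ∈ acl L A s) :
    ext s σ x = σ.act s ⟨x, h⟩ := by
  classical
  exact Equiv.Perm.ofSubtype_apply_of_mem _ h

theorem ext_of_notMem (σ : AbsGal L A) {s : S} {x : N s} (h : x ∉ acl L A s) :
    ext s σ x = x := by
  classical
  exact Equiv.Perm.ofSubtype_apply_of_not_mem _ h

theorem ext_mem (σ : AbsGal L A) {s : S} {x : N s} (h : x ∈ acl L A s) :
    ext s σ x ∈ acl L A s := by
  rw [ext_of_mem σ h]; exact Subtype.property _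

theorem ext_mul (σ τ : AbsGal L A) (s : S) (x : N s) : ext s (σ * τ) x = ext s σ (ext s τ x) := by
  rw [map_mul]; rfl

theorem ext_one (s : S) (x : N s) : ext s (1 : AbsGal L A) x = x := by
  rw [map_one]; rfl

theorem ext_inv_eq_iff (σ : AbsGal L A) {s : S} {x y : N s} :
    ext s σ⁻¹ x = y ↔ x = ext s σ y := by
  rw [map_inv]; exact Equiv.Perm.inv_eq_iff_eq

theorem ext_inv_ext (σ : AbsGal L A) {s : S} {x : N s} : ext s σ⁻¹ (ext s σ x) = x :=
  σ.ext_inv_eq_iff.2 rfl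

theorem ext_ext_inv (σ : AbsGal L A) {s : S} {x : N s} : ext s σ (ext s σ⁻¹ x) = x :=
  (σ.ext_inv_eq_iff.1 rfl).symm

theorem eq_of_ext {σ τ : AbsGal L A} (h : ∀ s, ∀ x ∈ acl L A s, ext s σ x = ext s τ x) :
    σ = τ := by
  refine Subtype.ext ?_
  funext s
  ext x
  have := h s x x.2
  rwa [ext_of_mem σ x.2, ext_of_mem τ x.2] at this

theorem ext_of_mem_dcl (σ : AbsGal L A) {s : S} {x : N s} (h : x ∈ dcl L A s) :
    ext s σ x = x := by
  rw [ext_of_mem σ (dcl_subset_acl s h)]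
  exact congrArg Subtype.val (σ.2.2.2 s ⟨x, dcl_subset_acl s h⟩ h)

end AbsGal

theorem mem_fixedPoints {H : Subgroup (AbsGal L A)} {s : S} {x : N s} :
    x ∈ fixedPoints H s ↔ x ∈ acl L A s ∧ ∀ σ ∈ H, AbsGal.ext s σ x = x := by
  constructor
  · rintro ⟨h, hx⟩
    exact ⟨h, fun σ hσ => by rw [AbsGal.ext_of_mem σ h, hx σ hσ]⟩
  · rintro ⟨h, hx⟩
    exact ⟨h, fun σ hσ => Subtype.ext (by rw [← AbsGal.ext_of_mem σ h, hx σ hσ])⟩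

section QE

variable {T : Theory L} (hQE : T.HasQE) (hN : T.IsModel N)

theorem autGroup_realize_term (hB : ∀ s, dcl L B s ⊆ B s) {σ : ∀ s, Equiv.Perm (B s)}
    (hσ : σ ∈ autGroup L B A) {Γ : List S} (v : ∀ s, Var Γ s → B s) {s : S} (t : Term L Γ s) :
    ∃ h : t.realize (fun s i => (v s i : N s)) ∈ B s,
      t.realize (fun s i => (σ s (v s i) : N s)) = σ s ⟨_, h⟩ := by
  induction t with
  | var i => exact ⟨(v _ i).2, rfl⟩
  | @func Δ s f ts ih =>
    choose h heq using ih
    have hmem : (Term.func f ts).realize (fun s i => (v s i : N s)) ∈ B s :=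
      hB s (funMap_mem_dcl f _ h)
    refine ⟨hmem, ?_⟩
    have := (hσ.1 Δ s f (fun t i => ⟨_, h t i⟩) ⟨_, hmem⟩).1 rfl
    rw [← this]
    simp only [Term.realize]
    congr 1
    funext t i
    exact heq t i

theorem autGroup_realize_of_isQF (hB : ∀ s, dcl L B s ⊆ B s) {σ : ∀ s, Equiv.Perm (B s)}
    (hσ : σ ∈ autGroup L B A) {Γ : List S} (v : ∀ s, Var Γ s → B s) (φ : Formula L Γ)
    (hφ : φ.IsQF) :
    φ.Realize (fun s i => (v s i : N s)) ↔ φ.Realize (fun s i => (σ s (v s i) : N s)) := by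
  induction φ with
  | falsum => exact Iff.rfl
  | equal t₁ t₂ =>
    obtain ⟨h₁, e₁⟩ := autGroup_realize_term hB hσ v t₁
    obtain ⟨h₂, e₂⟩ := autGroup_realize_term hB hσ v t₂
    simp only [Formula.Realize]
    rw [e₁, e₂, Subtype.coe_inj, (σ _).injective.eq_iff, Subtype.mk.injEq]
  | rel R ts =>
    have h := fun t i => (autGroup_realize_term hB hσ v (ts t i))
    choose h heq using h
    simp only [Formula.Realize]
    refine (hσ.2.1 _ R (fun t i => ⟨_, h t i⟩)).trans (iff_of_eq ?_)
    congr 1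
    funext t i
    exact (heq t i).symm
  | imp φ ψ ihφ ihψ =>
    simp only [Formula.Realize]
    rw [ihφ v hφ.1, ihψ v hφ.2]
  | all φ => exact hφ.elim

-- Quantifier elimination enters here: automorphisms are only required to preserve the symbols on
-- `B`, which need not be an elementary substructure.
include hQE hN in
theorem autGroup_realize (hB : ∀ s, dcl L B s ⊆ B s) {σ : ∀ s, Equiv.Perm (B s)}
    (hσ : σ ∈ autGroup L B A) {Γ : List S} (v : ∀ s, Var Γ s → B s) (φ : Formula L Γ) :
    φ.Realize (fun s i => (v s i : N s)) ↔ φ.Realize (fun s i => (σ s (v s i) : N s)) := by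
  obtain ⟨ψ, hψ, h⟩ := hQE Γ φ
  rw [h N hN, h N hN]
  exact autGroup_realize_of_isQF hB hσ v ψ hψ

include hQE hN in
/-- The graph of an automorphism is elementary. -/
theorem isElementary_graph (hB : ∀ s, dcl L B s ⊆ B s) {σ : ∀ s, Equiv.Perm (B s)}
    (hσ : σ ∈ autGroup L B A) :
    IsElementary L
      {p : Σ s, N s × N s | ∃ h : p.2.1 ∈ B p.1, (σ p.1 ⟨p.2.1, h⟩ : N p.1) = p.2.2} := by
  intro Γ u v h φ hu
  choose hm he using h
  have := (autGroup_realize hQE hN hB hσ (fun s i => ⟨u s i, hm s i⟩) φ).1 hu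
  convert this using 1
  funext s i
  exact (he s i).symm

include hQE hN in
theorem AbsGal.realize_ext (σ : AbsGal L A) {Γ : List S} (v : Tuple N Γ)
    (hv : ∀ s i, v s i ∈ acl L A s) (φ : Formula L Γ) :
    φ.Realize (fun s i => AbsGal.ext s σ (v s i)) ↔ φ.Realize v := by
  rw [autGroup_realize hQE hN dcl_acl_subset σ.2 (fun s i => ⟨v s i, hv s i⟩) φ]
  refine iff_of_eq (congrArg _ ?_)
  funext s i
  exact AbsGal.ext_of_mem σ (hv s i)

end QE

/-- An elementary relation on `acl(A)` which is the identity on `A` extends to an element of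
`𝒢(A)`. -/
theorem IsElementary.exists_absGal {R : Set (Σ s, N s × N s)} (hR : IsElementary L R)
    (hacl : ∀ p ∈ R, p.2.1 ∈ acl L A p.1) (hA : ∀ s, ∀ a ∈ A s, ⟨s, a, a⟩ ∈ R) :
    ∃ σ : AbsGal L A, ∀ s x y, (⟨s, x, y⟩ : Σ s, N s × N s) ∈ R → AbsGal.ext s σ x = y := by
  -- A maximal elementary extension with domain inside `acl A` is total by the extension step, and
  -- surjective by the same step applied to its inverse.
  obtain ⟨m, hRm, ⟨hm, hmacl⟩, hmax⟩ := zorn_subset_nonempty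
    {R' | IsElementary L R' ∧ ∀ p ∈ R', p.2.1 ∈ acl L A p.1}
    (fun c hc hchain hne => ⟨⋃₀ c, ⟨IsElementary.sUnion (fun R hR => (hc hR).1) hchain hne, by
      rintro p ⟨R, hR, hp⟩; exact (hc hR).2 p hp⟩, fun R hR => Set.subset_sUnion_of_mem hR⟩)
    R ⟨hR, hacl⟩
  have hAm : ∀ s, ∀ a ∈ A s, (⟨s, a, a⟩ : Σ s, N s × N s) ∈ m := fun s a ha => hRm (hA s a ha)
  have hadd : ∀ s x y, x ∈ acl L A s → IsElementary L (insert ⟨s, x, y⟩ m) →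
      (⟨s, x, y⟩ : Σ s, N s × N s) ∈ m := by
    intro s x y hx h
    refine hmax (y := insert ⟨s, x, y⟩ m) ⟨h, ?_⟩ (Set.subset_insert _ _) (Set.mem_insert _ _)
    rintro p (rfl | hp)
    · exact hx
    · exact hmacl p hp
  have htot : ∀ s (x : acl L A s), ∃ y : acl L A s, (⟨s, x, y⟩ : Σ s, N s × N s) ∈ m := by
    rintro s ⟨x, hx⟩
    obtain ⟨y, hy⟩ := hm.exists_adjoin (fun s a ha => ⟨a, hAm s a ha⟩) hx
    have := hadd s x y hx hy
    exact ⟨⟨y, hm.mem_acl hAm hx this⟩, this⟩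
  have hsurj : ∀ s (y : acl L A s), ∃ x : acl L A s, (⟨s, x, y⟩ : Σ s, N s × N s) ∈ m := by
    rintro s ⟨y, hy⟩
    obtain ⟨x, hx⟩ := hm.symm.exists_adjoin (fun s a ha => ⟨a, hAm s a ha⟩) hy
    have hxacl : x ∈ acl L A s := hx.mem_acl (fun s a ha => Set.mem_insert_of_mem _ (hAm s a ha)) hy
      (Set.mem_insert _ _)
    refine ⟨⟨x, hxacl⟩, hadd s x y hxacl ?_⟩
    convert hx.symm using 1
    ext ⟨t, a, b⟩
    simp only [Set.mem_insert_iff, Set.mem_ofPred_eq, Sigma.mk.injEq]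
    refine or_congr (and_congr_right ?_) Iff.rfl
    rintro rfl
    simp [and_comm]
  choose f hf using htot
  choose g hg using hsurj
  let σ : ∀ s, Equiv.Perm (acl L A s) := fun s =>
    ⟨f s, g s, fun x => Subtype.ext ((hm.eq_iff (hg s (f s x)) (hf s x)).2 rfl),
      fun x => Subtype.ext ((hm.eq_iff (hf s (g s x)) (hg s x)).1 rfl)⟩
  have hσm : ∀ s (x : acl L A s), (⟨s, x, σ s x⟩ : Σ s, N s × N s) ∈ m := hf
  have hσ : σ ∈ autGroup L (acl L A) (dcl L A) := by
    refine ⟨fun Δ s h x y => ?_, fun Δ R x => ?_, fun s x hx => ?_⟩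
    · refine hm.iff (u := Tuple.cons (M := N) (y : N s) (fun t i => (x t i : N t)))
        (v := Tuple.cons (M := N) (σ s y : N s) (fun t i => (σ t (x t i) : N t))) ?_
        (.equal (.func h (fun t i => .var (.succ i))) (.var .zero))
      rintro t (_ | i)
      · exact hσm _ _
      · exact hσm _ _
    · exact hm.iff (u := (fun t i => (x t i : N t))) (v := (fun t i => (σ t (x t i) : N t)))
        (fun _ _ => hσm _ _) (.rel R (fun t i => .var i))
    · obtain ⟨Δ, φ, b, hb, h⟩ := hx
      exact Subtype.ext ((h _).1 ((hm.mem_iff_of_formula hAm (hσm s x) φ hb).1 ((h _).2 rfl)))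
  let σ' : AbsGal L A := ⟨σ, hσ⟩
  refine ⟨σ', fun s x y hxy => ?_⟩
  have hx : x ∈ acl L A s := hacl _ hxy
  rw [AbsGal.ext_of_mem σ' hx]
  exact ((hm.eq_iff (hσm s ⟨x, hx⟩) (hRm hxy)).1 rfl)

/-- If `x ∈ acl(A)` is fixed by all elements of `𝒢(A)` which fix `B`, then `x ∈ dcl(A ∪ B)`. -/
theorem mem_dcl_of_fixed (hAB : ∀ s, A s ⊆ B s) (hB : ∀ s, B s ⊆ acl L A s) {s : S} {x : N s}
    (hx : x ∈ acl L A s)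
    (h : ∀ σ : AbsGal L A, (∀ t, ∀ b ∈ B t, AbsGal.ext t σ b = b) → AbsGal.ext s σ x = x) :
    x ∈ dcl L B s := by
  obtain ⟨Δ, φ, b, hb, hφ, hiso⟩ := exists_isolating (acl_mono hAB s hx)
  refine ⟨Δ, φ, b, hb, fun y => ⟨fun hy => ?_, fun hy => hy ▸ hφ⟩⟩
  let R : Set (Σ s, N s × N s) := {p | p.2.1 ∈ B p.1 ∧ p.2.2 = p.2.1}
  have hR : IsElementary L R := by
    intro Γ u v huv ψ hu
    have : v = u := by funext s i; exact (huv s i).2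
    rwa [this]
  -- If the isolating formula had another solution `y`, the identity on `B` together with `(x, y)`
  -- would be elementary, hence extend to an automorphism fixing `B` and moving `x`.
  have hR' : IsElementary L (insert ⟨s, x, y⟩ R) :=
    hR.adjoin (b := b) (c := b) (fun t i => ⟨hb t i, rfl⟩) hy
      (fun Δ' ψ b' hb' => hiso Δ' ψ b' fun t i => (hb' t i).choose_spec.1)
  obtain ⟨σ, hσ⟩ := hR'.exists_absGal (A := A) (by
    rintro p (rfl | hp)
    · exact hx
    · exact hB _ hp.1) (fun s a ha => Set.mem_insert_of_mem _ ⟨hAB s ha, rfl⟩)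
  rw [← hσ s x y (Set.mem_insert _ _)]
  exact h σ fun t c hc => hσ t c c (Set.mem_insert_of_mem _ ⟨hc, rfl⟩)

theorem mem_dcl_of_forall_fixed {s : S} {x : N s} (hx : x ∈ acl L A s)
    (h : ∀ σ : AbsGal L A, AbsGal.ext s σ x = x) : x ∈ dcl L A s :=
  mem_dcl_of_fixed (fun _ => subset_rfl) subset_acl hx fun σ _ => h σ

end GaloisAction

/-! ### Canonical parameters of finite sets of tuples -/

section Codes

variable {S : Type u} {L : Language S} {Γ Λ : List S}

/-- `b` is the canonical parameter, with respect to the formula `ψ`, of the set of the tuples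
obtained from `e` by the permutations of the variables in the group `P`. -/
def IsCode {N : S → Type u} [Structure L N] (P : Subgroup (∀ s, Equiv.Perm (Var Γ s)))
    (ψ : Formula L (Γ ++ Λ)) (e : Tuple N Γ) (b : Tuple N Λ) : Prop :=
  (∀ x : Tuple N Γ, (∃ r ∈ P, x = e.sub (fun s i => r s i)) ↔ ψ.Realize (Tuple.append x b)) ∧
    ∀ b' : Tuple N Λ, (∀ x : Tuple N Γ, (∃ r ∈ P, x = e.sub (fun s i => r s i)) ↔
      ψ.Realize (Tuple.append x b')) → b' = b

theorem exists_formula_perm (P : Subgroup (∀ s, Equiv.Perm (Var Γ s))) :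
    ∃ θ : Formula L (Γ ++ Γ), ∀ (N : S → Type u) [Structure L N] (x e : Tuple N Γ),
      θ.Realize (Tuple.append x e) ↔ ∃ r ∈ P, x = e.sub (fun s i => r s i) := by
  choose f hf using fun r : P => Formula.exists_tupleEq (L := L) (Tuple.left Γ Γ)
    ((Tuple.right Γ Γ).sub (fun s i => r.1 s i))
  obtain ⟨θ, hθ⟩ := Formula.exists_iSup f
  refine ⟨θ, fun N _ x e => ?_⟩
  simp [hθ, hf, Tuple.sub_sub]

/-- Being a code is expressed by a formula independent of the structure; hence codes are respected
by automorphisms and pass through Łoś's theorem. -/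
theorem exists_formula_isCode (P : Subgroup (∀ s, Equiv.Perm (Var Γ s))) (ψ : Formula L (Γ ++ Λ)) :
    ∃ ξ : Formula L (Λ ++ Γ), ∀ (N : S → Type u) [Structure L N] (b : Tuple N Λ) (e : Tuple N Γ),
      ξ.Realize (Tuple.append b e) ↔ IsCode P ψ e b := by
  obtain ⟨θ, hθ⟩ := exists_formula_perm (L := L) P
  obtain ⟨δ, hδ⟩ := Formula.exists_tupleEq (L := L) (Tuple.left Λ (Λ ++ Γ))
    ((Tuple.right Λ (Λ ++ Γ)).sub (Tuple.left Λ Γ))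
  let κ : Formula L (Λ ++ Γ) := .allT Γ (.iff
    (θ.rename (Tuple.append (Tuple.left Γ (Λ ++ Γ))
      ((Tuple.right Γ (Λ ++ Γ)).sub (Tuple.right Λ Γ))))
    (ψ.rename (Tuple.append (Tuple.left Γ (Λ ++ Γ))
      ((Tuple.right Γ (Λ ++ Γ)).sub (Tuple.left Λ Γ)))))
  have hκ : ∀ (N : S → Type u) [Structure L N] (b : Tuple N Λ) (e : Tuple N Γ),
      κ.Realize (Tuple.append b e) ↔ ∀ x : Tuple N Γ, (∃ r ∈ P, x = e.sub (fun s i => r s i)) ↔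
        ψ.Realize (Tuple.append x b) := by
    intro N _ b e
    simp only [κ, Formula.realize_allT, Formula.realize_iff, Formula.realize_rename,
      Tuple.sub_append, Tuple.sub_sub, Tuple.append_sub_left, Tuple.append_sub_right, hθ]
  refine ⟨.and κ (.allT Λ (.imp (κ.rename (Tuple.append (Tuple.left Λ (Λ ++ Γ))
      ((Tuple.right Λ (Λ ++ Γ)).sub (Tuple.right Λ Γ)))) δ)), fun N _ b e => ?_⟩
  simp only [Formula.realize_and, Formula.realize_allT, Formula.realize_imp,
    Formula.realize_rename,
      Tuple.sub_append, Tuple.sub_sub, Tuple.append_sub_left, Tuple.append_sub_right, hδ, hκ]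
  rfl

variable {N : S → Type u} [Structure L N] {A : ∀ s, Set (N s)}
  {P : Subgroup (∀ s, Equiv.Perm (Var Γ s))} {ψ : Formula L (Γ ++ Λ)} {e : Tuple N Γ}
  {b : Tuple N Λ}

/-- Differing by a permutation in `P` is an equivalence relation definable without parameters,
because `P` is a finite group; elimination of imaginaries applies to the class of `e`. -/
theorem Theory.HasEI.exists_isCode {T : Theory L} (hEI : T.HasEI) (hN : T.IsModel N)
    (P : Subgroup (∀ s, Equiv.Perm (Var Γ s))) (e : Tuple N Γ) :
    ∃ (Λ : List S) (ψ : Formula L (Γ ++ Λ)) (b : Tuple N Λ), IsCode P ψ e b := by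
  obtain ⟨θ, hθ⟩ := exists_formula_perm (L := L) P
  obtain ⟨Λ, ψ, b, hb, hu⟩ := hEI N hN Γ θ ⟨fun x => (hθ N x x).2 ⟨1, P.one_mem, rfl⟩,
    fun {x y} h => by
      obtain ⟨r, hr, rfl⟩ := (hθ N x y).1 h
      refine (hθ N _ _).2 ⟨r⁻¹, P.inv_mem hr, ?_⟩
      funext s i
      simp [Tuple.sub],
    fun {x y z} h h' => by
      obtain ⟨r, hr, rfl⟩ := (hθ N x y).1 h
      obtain ⟨r', hr', rfl⟩ := (hθ N y z).1 h'
      exact (hθ N _ _).2 ⟨r' * r, P.mul_mem hr' hr, rfl⟩⟩ e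
  refine ⟨Λ, ψ, b, fun x => ?_, fun b' hb' => hu b' fun x => ?_⟩
  · rw [← hθ, hb]
  · rw [hθ, hb']

theorem IsCode.eq {b' : Tuple N Λ} (h : IsCode P ψ e b) (h' : IsCode P ψ e b') : b' = b :=
  h.2 b' h'.1

theorem IsCode.of_sub {r : ∀ s, Equiv.Perm (Var Γ s)} (hr : r ∈ P)
    (h : IsCode P ψ (e.sub (fun s i => r s i)) b) : IsCode P ψ e b := by
  have key : ∀ x : Tuple N Γ, (∃ r' ∈ P, x = (e.sub (fun s i => r s i)).sub (fun s i => r' s i)) ↔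
      ∃ r' ∈ P, x = e.sub (fun s i => r' s i) := by
    intro x
    constructor
    · rintro ⟨r', hr', rfl⟩
      exact ⟨r * r', P.mul_mem hr hr', rfl⟩
    · rintro ⟨r', hr', rfl⟩
      refine ⟨r⁻¹ * r', P.mul_mem (P.inv_mem hr) hr', ?_⟩
      funext s i
      simp [Tuple.sub]
  simpa only [IsCode, key] using h

theorem IsCode.mem_acl (h : IsCode P ψ e b) (he : ∀ s i, e s i ∈ acl L A s) (s : S)
    (i : Var Λ s) : b s i ∈ acl L A s := by
  obtain ⟨ξ, hξ⟩ := exists_formula_isCode P ψ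
  refine dcl_acl_subset s (mem_dcl_of_tuple ξ he (fun b' => ?_) s i)
  rw [hξ]
  exact ⟨fun h' => h.eq h', fun h' => h' ▸ h⟩

theorem IsCode.ext {T : Theory L} (hQE : T.HasQE) (hN : T.IsModel N) (σ : AbsGal L A)
    (h : IsCode P ψ e b) (he : ∀ s i, e s i ∈ acl L A s) :
    IsCode P ψ (fun s i => AbsGal.ext s σ (e s i)) (fun s i => AbsGal.ext s σ (b s i)) := by
  obtain ⟨ξ, hξ⟩ := exists_formula_isCode P ψ
  rw [← hξ] at h ⊢
  have hmem : ∀ s i, Tuple.append b e s i ∈ acl L A s := by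
    intro s i
    rcases Var.inl_or_inr i with ⟨j, rfl⟩ | ⟨j, rfl⟩
    · simpa using IsCode.mem_acl ((hξ N b e).1 h) he s j
    · simpa using he s j
  have := (σ.realize_ext hQE hN (Tuple.append b e) hmem ξ).2 h
  convert this using 1
  exact Tuple.append_ext (fun s i => by simp) (fun s i => by simp)

end Codes

/-! ### Listing finite sets as tuples -/

section Enumerate

variable {S : Type u} {N : S → Type u}

theorem exists_enumeration {X : Set (Σ s, N s)} (hX : X.Finite) :
    ∃ (Γ : List S) (e : Tuple N Γ), (∀ s, Function.Injective (e s)) ∧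
      ∀ s x, (⟨s, x⟩ : Σ s, N s) ∈ X ↔ ∃ i, e s i = x := by
  induction X, hX using Set.Finite.induction_on with
  | empty =>
    refine ⟨[], Tuple.nil, ?_, fun s x => ?_⟩
    · rintro s ⟨⟩
    · simp only [Set.mem_empty_iff_false, false_iff]
      rintro ⟨⟨⟩, _⟩
  | @insert a X ha _ ih =>
    obtain ⟨Γ, e, hinj, he⟩ := ih
    obtain ⟨t, a⟩ := a
    refine ⟨t :: Γ, Tuple.cons a e, ?_, ?_⟩
    · rintro s (_ | i) (_ | j) h
      · rfl
      · exact absurd ((he _ _).2 ⟨j, h.symm⟩) ha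
      · exact absurd ((he _ _).2 ⟨i, h⟩) ha
      · rw [hinj s h]
    · intro s x
      rw [Set.mem_insert_iff, he]
      constructor
      · rintro (h | ⟨i, rfl⟩)
        · obtain rfl : s = t := congrArg Sigma.fst h
          simp only [Sigma.mk.injEq, heq_eq_eq, true_and] at h
          exact ⟨.zero, h.symm⟩
        · exact ⟨.succ i, rfl⟩
      · rintro ⟨_ | i, rfl⟩
        · exact Or.inl rfl
        · exact Or.inr ⟨i, rfl⟩

theorem exists_perm_of_invariant {Γ : List S} {e : Tuple N Γ} (hinj : ∀ s, Function.Injective (e s))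
    (f : ∀ s, Equiv.Perm (N s)) (hf : ∀ s i, ∃ j, e s j = f s (e s i)) :
    ∃ r : ∀ s, Equiv.Perm (Var Γ s), ∀ s i, f s (e s i) = e s (r s i) := by
  choose g hg using hf
  have hg' : ∀ s, Function.Injective (g s) := by
    intro s i j hij
    refine hinj s ((f s).injective ?_)
    rw [← hg, ← hg, hij]
  exact ⟨fun s => Equiv.ofBijective (g s) (Finite.injective_iff_bijective.1 (hg' s)),
    fun s i => (hg s i).symm⟩

end Enumerate

/-! ### Galois correspondence up to closure -/

section Density

variable {S : Type u} {L : Language S} {N : S → Type u} [Structure L N] {A : ∀ s, Set (N s)}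
  {T : Theory L} (hQE : T.HasQE) (hN : T.IsModel N)

include hQE hN in
theorem AbsGal.realize_cons_ext (σ : AbsGal L A) {s : S} {x : N s} (hx : x ∈ acl L A s)
    {Δ : List S} {b : Tuple N Δ} (hb : ∀ t i, b t i ∈ A t) (φ : Formula L (s :: Δ)) :
    φ.Realize (Tuple.cons (ext s σ x) b) ↔ φ.Realize (Tuple.cons x b) := by
  rw [← σ.realize_ext hQE hN (Tuple.cons x b) (by
    rintro t (_ | i)
    · exact hx
    · exact subset_acl _ (hb _ _)) φ]
  refine iff_of_eq (congrArg _ ?_)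
  funext t i
  rcases i with _ | i
  · rfl
  · exact (σ.ext_of_mem_dcl (subset_dcl _ (hb _ _))).symm

include hQE hN in
theorem AbsGal.finite_orbit (s : S) (x : N s) :
    (Set.range fun σ : AbsGal L A => ext s σ x).Finite := by
  by_cases hx : x ∈ acl L A s
  · obtain ⟨Δ, φ, b, hb, hφ, hfin⟩ := id hx
    refine hfin.subset ?_
    rintro _ ⟨σ, rfl⟩
    exact (σ.realize_cons_ext hQE hN hx hb φ).2 hφ
  · refine (Set.finite_singleton x).subset ?_
    rintro _ ⟨σ, rfl⟩
    exact σ.ext_of_notMem hx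

include hQE hN in
/-- An automorphism which fixes the fixed points of `H` is in the closure of `H`. -/
theorem exists_mem_eqOn_of_fixes (hEI : T.HasEI) (H : Subgroup (AbsGal L A)) (σ : AbsGal L A)
    (hσ : ∀ s, ∀ x ∈ fixedPoints H s, AbsGal.ext s σ x = x) {C : Set (Σ s, N s)} (hC : C.Finite)
    (hCA : ∀ p ∈ C, p.2 ∈ acl L A p.1) :
    ∃ h ∈ H, ∀ p ∈ C, AbsGal.ext p.1 h p.2 = AbsGal.ext p.1 σ p.2 := by
  -- `X` is the union of the `H`-orbits of `C`: finite and stable under `H`, so that `H` permutes an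
  -- enumeration `e` of it.
  let X : Set (Σ s, N s) := {q | ∃ p ∈ C, ∃ h ∈ H, q = ⟨p.1, AbsGal.ext p.1 h p.2⟩}
  have hX : X.Finite := by
    refine (hC.biUnion fun p _ => (AbsGal.finite_orbit (A := A) hQE hN p.1 p.2).image
      (Sigma.mk p.1)).subset ?_
    rintro _ ⟨p, hp, h, -, rfl⟩
    exact Set.mem_biUnion hp ⟨_, ⟨h, rfl⟩, rfl⟩
  have hXinv : ∀ h ∈ H, ∀ s x, (⟨s, x⟩ : Σ s, N s) ∈ X →
      (⟨s, AbsGal.ext s h x⟩ : Σ s, N s) ∈ X := by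
    rintro h hh s x ⟨p, hp, h', hh', heq⟩
    obtain ⟨t, c⟩ := p
    obtain rfl : s = t := congrArg Sigma.fst heq
    simp only [Sigma.mk.injEq, heq_eq_eq, true_and] at heq
    exact ⟨_, hp, h * h', H.mul_mem hh hh', by rw [AbsGal.ext_mul, heq]⟩
  obtain ⟨Γ, e, hinj, he⟩ := exists_enumeration hX
  have heA : ∀ s i, e s i ∈ acl L A s := by
    intro s i
    obtain ⟨p, hp, h', -, heq⟩ := (he s (e s i)).2 ⟨i, rfl⟩
    obtain ⟨t, c⟩ := p
    obtain rfl : s = t := congrArg Sigma.fst heq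
    simp only [Sigma.mk.injEq, heq_eq_eq, true_and] at heq
    rw [heq]
    exact AbsGal.ext_mem _ (hCA _ hp)
  -- The permutations of the enumeration induced by elements of `H`.
  let P : Subgroup (∀ s, Equiv.Perm (Var Γ s)) :=
    { carrier := {r | ∃ h ∈ H, ∀ s i, AbsGal.ext s h (e s i) = e s (r s i)}
      one_mem' := ⟨1, H.one_mem, fun s i => AbsGal.ext_one s _⟩
      mul_mem' := by
        rintro r r' ⟨h, hh, hr⟩ ⟨h', hh', hr'⟩
        refine ⟨h * h', H.mul_mem hh hh', fun s i => ?_⟩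
        rw [AbsGal.ext_mul, hr', hr]
        rfl
      inv_mem' := by
        rintro r ⟨h, hh, hr⟩
        refine ⟨h⁻¹, H.inv_mem hh, fun s i => ?_⟩
        rw [AbsGal.ext_inv_eq_iff, hr]
        simp }
  have hP : ∀ h ∈ H, ∃ r ∈ P, (fun s i => AbsGal.ext s h (e s i)) = e.sub (fun s i => r s i) := by
    intro h hh
    obtain ⟨r, hr⟩ := exists_perm_of_invariant hinj (fun s => AbsGal.ext s h)
      (fun s i => (he _ _).1 (hXinv h hh s _ ((he _ _).2 ⟨i, rfl⟩)))
    exact ⟨r, ⟨h, hh, hr⟩, by funext s i; exact hr s i⟩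
  obtain ⟨Λ, ψ, b, hb⟩ := hEI.exists_isCode hN P e
  have hbA := hb.mem_acl heA
  have hbH : ∀ s i, b s i ∈ fixedPoints H s := by
    intro s i
    refine mem_fixedPoints.2 ⟨hbA s i, fun h hh => ?_⟩
    obtain ⟨r, hr, heq⟩ := hP h hh
    have := hb.ext hQE hN h heA
    rw [heq] at this
    exact congrFun (congrFun (hb.eq (this.of_sub hr)) s) i
  have hbσ : (fun s i => AbsGal.ext s σ (b s i)) = b := by
    funext s i; exact hσ s _ (hbH s i)
  -- The code of the `P`-orbit of `e` is fixed by `H`, hence by `σ`. Therefore `σ e` lies in that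
  -- orbit, so some `h ∈ H` acts on `e` as `σ` does.
  have hσb := hb.ext hQE hN σ heA
  rw [hbσ] at hσb
  obtain ⟨r, ⟨h, hh, hr⟩, heq⟩ := (hb.1 _).2 ((hσb.1 (fun s i => AbsGal.ext s σ (e s i))).1
    ⟨1, P.one_mem, rfl⟩)
  refine ⟨h, hh, fun p hp => ?_⟩
  obtain ⟨i, hi⟩ := (he p.1 p.2).1 ⟨p, hp, 1, H.one_mem, by rw [AbsGal.ext_one]⟩
  rw [← hi, hr]
  exact (congrFun (congrFun heq p.1) i).symm

end Density

/-! ### Open subgroups of the Galois group -/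

section Topology

variable {S : Type u} {L : Language S} {N : S → Type u} [Structure L N] {A : ∀ s, Set (N s)}

theorem AbsGal.isOpen_setOf_ext_eq {s : S} (x y : N s) :
    IsOpen {σ : AbsGal L A | ext s σ x = y} := by
  by_cases hx : x ∈ acl L A s
  · by_cases hy : y ∈ acl L A s
    · refine TopologicalSpace.isOpen_generateFrom_of_mem ⟨s, ⟨x, hx⟩, ⟨y, hy⟩, ?_⟩
      ext σ
      simp only [Set.mem_ofPred_eq, ext_of_mem σ hx, Subtype.ext_iff]
    · convert isOpen_empty
      ext σ
      simp only [Set.mem_ofPred_eq, Set.mem_empty_iff_false, iff_false]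
      rintro rfl
      exact hy (ext_mem σ hx)
  · simp only [ext_of_notMem _ hx]
    exact isOpen_const

theorem AbsGal.isOpen_iff {V : Set (AbsGal L A)} :
    IsOpen V ↔ ∀ σ ∈ V, ∃ C : Set (Σ s, N s), C.Finite ∧ (∀ p ∈ C, p.2 ∈ acl L A p.1) ∧
      ∀ τ : AbsGal L A, (∀ p ∈ C, ext p.1 τ p.2 = ext p.1 σ p.2) → τ ∈ V := by
  constructor
  · intro hV
    induction hV with
    | basic V hV =>
      obtain ⟨s, x, y, rfl⟩ := hV
      intro σ hσ
      refine ⟨{⟨s, x⟩}, Set.finite_singleton _, by rintro _ rfl; exact x.2, fun τ hτ => ?_⟩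
      have := hτ _ rfl
      rw [ext_of_mem τ x.2, ext_of_mem σ x.2] at this
      exact (Subtype.ext this).trans hσ
    | univ => exact fun σ _ => ⟨∅, Set.finite_empty, by simp, fun τ _ => trivial⟩
    | inter V W _ _ ihV ihW =>
      intro σ hσ
      obtain ⟨C, hC, hCA, h⟩ := ihV σ hσ.1
      obtain ⟨C', hC', hCA', h'⟩ := ihW σ hσ.2
      refine ⟨C ∪ C', hC.union hC', ?_, fun τ hτ =>
        ⟨h τ fun p hp => hτ p (Or.inl hp), h' τ fun p hp => hτ p (Or.inr hp)⟩⟩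
      rintro p (hp | hp)
      · exact hCA p hp
      · exact hCA' p hp
    | sUnion c _ ih =>
      rintro σ ⟨V, hV, hσ⟩
      obtain ⟨C, hC, hCA, h⟩ := ih V hV σ hσ
      exact ⟨C, hC, hCA, fun τ hτ => ⟨V, hV, h τ hτ⟩⟩
  · intro h
    refine isOpen_iff_forall_mem_open.2 fun σ hσ => ?_
    obtain ⟨C, hC, -, hV⟩ := h σ hσ
    refine ⟨⋂ p ∈ C, {τ | ext p.1 τ p.2 = ext p.1 σ p.2}, ?_,
      hC.isOpen_biInter fun p _ => isOpen_setOf_ext_eq _ _, by simp⟩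
    intro τ hτ
    exact hV τ (by simpa using hτ)

theorem Subgroup.isOpen_iff_absGal {H : Subgroup (AbsGal L A)} :
    IsOpen (H : Set (AbsGal L A)) ↔
      ∃ C : Set (Σ s, N s), C.Finite ∧ (∀ p ∈ C, p.2 ∈ acl L A p.1) ∧
      ∀ τ : AbsGal L A, (∀ p ∈ C, AbsGal.ext p.1 τ p.2 = p.2) → τ ∈ H := by
  rw [AbsGal.isOpen_iff]
  constructor
  · intro h
    obtain ⟨C, hC, hCA, h⟩ := h 1 H.one_mem
    exact ⟨C, hC, hCA, fun τ hτ => h τ fun p hp => by rw [hτ p hp, AbsGal.ext_one]⟩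
  · rintro ⟨C, hC, hCA, h⟩ σ hσ
    refine ⟨C, hC, hCA, fun τ hτ => ?_⟩
    have : σ⁻¹ * τ ∈ H := h _ fun p hp => by
      rw [AbsGal.ext_mul, hτ p hp, AbsGal.ext_inv_ext]
    have := H.mul_mem hσ this
    rwa [mul_inv_cancel_left] at this

variable {T : Theory L} (hQE : T.HasQE) (hN : T.IsModel N)

-- By `exists_mem_eqOn_of_fixes`, `σ` is in the closure of `H`, and an open subgroup contains its
-- closure.
include hQE hN in
theorem mem_of_fixes_fixedPoints (hEI : T.HasEI) {H : Subgroup (AbsGal L A)}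
    (hH : IsOpen (H : Set (AbsGal L A))) {σ : AbsGal L A}
    (hσ : ∀ s, ∀ x ∈ fixedPoints H s, AbsGal.ext s σ x = x) : σ ∈ H := by
  obtain ⟨C, hC, hCA, h⟩ := Subgroup.isOpen_iff_absGal.1 hH
  obtain ⟨τ, hτ, heq⟩ := exists_mem_eqOn_of_fixes hQE hN hEI H σ hσ hC hCA
  have : τ⁻¹ * σ ∈ H := h _ fun p hp => by
    rw [AbsGal.ext_mul, ← heq p hp, AbsGal.ext_inv_ext]
  have := H.mul_mem hτ this
  rwa [mul_inv_cancel_left] at this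

include hQE hN in
theorem finite_quotient_of_isOpen {H : Subgroup (AbsGal L A)}
    (hH : IsOpen (H : Set (AbsGal L A))) : Finite (AbsGal L A ⧸ H) := by
  obtain ⟨C, hC, -, h⟩ := Subgroup.isOpen_iff_absGal.1 hH
  have := hC.to_subtype
  have : ∀ p : C, Finite (Set.range fun σ : AbsGal L A => AbsGal.ext p.1.1 σ p.1.2) := fun p =>
    (AbsGal.finite_orbit hQE hN _ _).to_subtype
  refine Finite.of_injective (fun (q : AbsGal L A ⧸ H) (p : C) =>
    (⟨_, ⟨q.out, rfl⟩⟩ : Set.range fun σ : AbsGal L A => AbsGal.ext p.1.1 σ p.1.2)) ?_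
  intro q q' hqq
  rw [← q.out_eq, ← q'.out_eq]
  refine QuotientGroup.eq.2 (h _ fun p hp => ?_)
  have := congrArg Subtype.val (congrFun hqq ⟨p, hp⟩)
  rw [AbsGal.ext_mul, AbsGal.ext_inv_eq_iff]
  exact this.symm

end Topology

/-! ### The cardinality condition as generation by one sort -/

section Sorted

variable {S : Type u} {L : Language S} {N : S → Type u} [Structure L N] {A : ∀ s, Set (N s)}
  {T : Theory L} (hQE : T.HasQE) (hN : T.IsModel N)

theorem fixedPoints_subset_acl (H : Subgroup (AbsGal L A)) (s : S) :
    fixedPoints H s ⊆ acl L A s := fun _ hx => (mem_fixedPoints.1 hx).1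

theorem dcl_subset_fixedPoints (H : Subgroup (AbsGal L A)) (s : S) :
    dcl L A s ⊆ fixedPoints H s := fun _ hx =>
  mem_fixedPoints.2 ⟨dcl_subset_acl s hx, fun σ _ => σ.ext_of_mem_dcl hx⟩

include hQE hN in
theorem AbsGal.ext_eq_of_mem_dcl {B : ∀ s, Set (N s)} (hB : ∀ s, B s ⊆ acl L A s)
    {σ : AbsGal L A} (hσ : ∀ s, ∀ x ∈ B s, ext s σ x = x) {s : S} {x : N s}
    (hx : x ∈ dcl L B s) : ext s σ x = x := by
  have hxA : x ∈ acl L A s := dcl_acl_subset s (dcl_mono hB s hx)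
  obtain ⟨Δ, φ, b, hb, h⟩ := hx
  rw [← h]
  have := (σ.realize_ext hQE hN (Tuple.cons x b) (by
    rintro t (_ | i)
    · exact hxA
    · exact hB _ (hb _ _)) φ).2 ((h x).2 rfl)
  convert this using 1
  funext t i
  rcases i with _ | i
  · rfl
  · exact (hσ _ _ (hb _ _)).symm

include hQE hN in
theorem dcl_fixedPoints (H : Subgroup (AbsGal L A)) (s : S) :
    dcl L (fixedPoints H) s ⊆ fixedPoints H s := fun _ hx =>
  mem_fixedPoints.2 ⟨dcl_acl_subset s (dcl_mono (fixedPoints_subset_acl H) s hx), fun _ hσ =>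
    AbsGal.ext_eq_of_mem_dcl hQE hN (fixedPoints_subset_acl H)
      (fun _ _ hy => (mem_fixedPoints.1 hy).2 _ hσ) hx⟩

theorem AbsGal.ext_mem_fixedPoints {H : Subgroup (AbsGal L A)} (hH : H.Normal) (σ : AbsGal L A)
    {s : S} {x : N s} (hx : x ∈ fixedPoints H s) : ext s σ x ∈ fixedPoints H s := by
  obtain ⟨hxA, hx⟩ := mem_fixedPoints.1 hx
  refine mem_fixedPoints.2 ⟨ext_mem σ hxA, fun τ hτ => ?_⟩
  have := hx _ (hH.conj_mem τ hτ σ⁻¹)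
  rwa [ext_mul, ext_mul, inv_inv, ext_inv_eq_iff] at this

include hQE hN in
/-- The elements of `𝒢(acl(A)^H/A)` extend to `acl(A)`. -/
theorem exists_ext_eq_of_mem_relGal {H : Subgroup (AbsGal L A)}
    (ρ : relGal L (fixedPoints H) A) :
    ∃ σ : AbsGal L A, ∀ s (x : dcl L (fixedPoints H) s), AbsGal.ext s σ x = ρ.1 s x := by
  have hB := fun s => dcl_mono (L := L) (dcl_fixedPoints hQE hN H) s
  obtain ⟨σ, hσ⟩ := (isElementary_graph hQE hN hB ρ.2).exists_absGal (A := A) (by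
    rintro ⟨s, x, y⟩ ⟨h, -⟩
    exact fixedPoints_subset_acl H s (dcl_fixedPoints hQE hN H s h)) (by
    intro s a ha
    have ha' : a ∈ dcl L A s := subset_dcl s ha
    exact ⟨subset_dcl s (dcl_subset_fixedPoints H s ha'),
      congrArg Subtype.val (ρ.2.2.2 s _ ha')⟩)
  exact ⟨σ, fun s x => hσ s _ _ ⟨x.2, rfl⟩⟩

include hQE hN in
/-- Restriction to `acl(A)^H`. -/
theorem exists_mem_relGal_eq_ext {H : Subgroup (AbsGal L A)} (hH : H.Normal) (σ : AbsGal L A) :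
    ∃ ρ : relGal L (fixedPoints H) A, ∀ s (x : dcl L (fixedPoints H) s),
      (ρ.1 s x : N s) = AbsGal.ext s σ x := by
  have hmem : ∀ s (x : N s), x ∈ dcl L (fixedPoints H) s ↔ x ∈ fixedPoints H s := fun s x =>
    ⟨fun h => dcl_fixedPoints hQE hN H s h, fun h => subset_dcl s h⟩
  let ρ : ∀ s, Equiv.Perm (dcl L (fixedPoints H) s) := fun s =>
    ⟨fun x => ⟨AbsGal.ext s σ x, (hmem _ _).2 (σ.ext_mem_fixedPoints hH ((hmem _ _).1 x.2))⟩,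
      fun x => ⟨AbsGal.ext s σ⁻¹ x, (hmem _ _).2 (σ⁻¹.ext_mem_fixedPoints hH ((hmem _ _).1 x.2))⟩,
      fun x => Subtype.ext σ.ext_inv_ext,
      fun x => Subtype.ext (by simp [map_inv])⟩
  have hacl : ∀ s (x : dcl L (fixedPoints H) s), (x : N s) ∈ acl L A s := fun s x =>
    fixedPoints_subset_acl H s ((hmem _ _).1 x.2)
  refine ⟨⟨ρ, fun Δ s f x y => ?_, fun Δ R x => ?_, fun s x hx => ?_⟩, fun s x => rfl⟩
  · have := (σ.realize_ext hQE hN (Tuple.cons (M := N) (y : N s) (fun t i => (x t i : N t))) (by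
      rintro t (_ | i)
      · exact hacl _ _
      · exact hacl _ _) (.equal (.func f (fun t i => .var (.succ i))) (.var .zero)))
    exact this.symm
  · exact (σ.realize_ext hQE hN (fun t i => (x t i : N t)) (fun t i => hacl _ _)
      (.rel R (fun t i => .var i))).symm
  · exact Subtype.ext (σ.ext_of_mem_dcl hx)

include hQE hN in
theorem finite_relGal {H : Subgroup (AbsGal L A)} (hH : IsOpen (H : Set (AbsGal L A))) :
    Finite (relGal L (fixedPoints H) A) := by
  have := finite_quotient_of_isOpen hQE hN hH
  choose f hf using exists_ext_eq_of_mem_relGal hQE hN (H := H)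
  refine Finite.of_injective (fun ρ => (f ρ : AbsGal L A ⧸ H)) ?_
  intro ρ ρ' h
  have h' := QuotientGroup.eq.1 h
  refine Subtype.ext ?_
  funext s
  ext x
  rw [← hf ρ, ← hf ρ']
  have := (mem_fixedPoints.1 (dcl_fixedPoints hQE hN H s x.2)).2 _ h'
  rwa [AbsGal.ext_mul, AbsGal.ext_inv_eq_iff, eq_comm] at this

include hQE hN in
/-- The cardinality condition in the definition of sorted maps says that the elements of sort `J`
of `acl(A)^H` generate it. -/
theorem mk_autSort_eq_iff (hEI : T.HasEI) {H : Subgroup (AbsGal L A)} (hHn : H.Normal)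
    (hH : IsOpen (H : Set (AbsGal L A))) (J : S) :
    Cardinal.mk (autSort L (fixedPoints H) A J) = Cardinal.mk (relGal L (fixedPoints H) A) ↔
      ∀ σ : AbsGal L A, (∀ x ∈ fixedPoints H J, AbsGal.ext J σ x = x) → σ ∈ H := by
  have := finite_relGal hQE hN hH
  let f : relGal L (fixedPoints H) A →* autSort L (fixedPoints H) A J :=
    (Pi.evalMonoidHom (fun s => Equiv.Perm (dcl L (fixedPoints H) s)) J).subgroupMap _
  have hf : Function.Surjective f := MonoidHom.subgroupMap_surjective _ _
  have hfJ : ∀ ρ, (f ρ).1 = ρ.1 J := fun ρ => rfl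
  constructor
  · intro hcard σ hσ
    obtain ⟨g⟩ := Cardinal.eq.1 hcard
    -- Both groups are finite, so equal cardinality forces the surjective restriction `f` to sort
    -- `J` to be injective.
    have hinj : Function.Injective f := (Finite.injective_iff_surjective_of_equiv g.symm).2 hf
    obtain ⟨ρ, hρ⟩ := exists_mem_relGal_eq_ext hQE hN hHn σ
    have hρ1 : ρ = 1 := by
      refine hinj (Subtype.ext ?_)
      rw [map_one, hfJ]
      ext x
      rw [hρ]
      exact hσ _ (dcl_fixedPoints hQE hN H J x.2)
    refine mem_of_fixes_fixedPoints hQE hN hEI hH fun s x hx => ?_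
    rw [← hρ s ⟨x, subset_dcl s hx⟩, hρ1]
    rfl
  · intro h
    refine (Cardinal.mk_congr (Equiv.ofBijective f ⟨?_, hf⟩)).symm
    rw [injective_iff_map_eq_one]
    intro ρ hρ
    obtain ⟨σ, hσ⟩ := exists_ext_eq_of_mem_relGal hQE hN ρ
    have hσJ : ∀ x ∈ fixedPoints H J, AbsGal.ext J σ x = x := by
      intro x hx
      rw [hσ J ⟨x, subset_dcl J hx⟩, ← hfJ, hρ]
      rfl
    refine Subtype.ext ?_
    funext s
    ext x
    rw [← hσ]
    exact (mem_fixedPoints.1 (dcl_fixedPoints hQE hN H s x.2)).2 _ (h σ hσJ)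

end Sorted

/-- Turns a lower bound on a cardinality into the existence of `n` distinct elements, a condition
that passes to ultraproducts coordinatewise. -/
theorem natCast_le_encard_iff {α : Type*} {X : Set α} {n : ℕ} :
    (n : ℕ∞) ≤ X.encard ↔ ∃ f : Fin n → α, Function.Injective f ∧ ∀ j, f j ∈ X := by
  constructor
  · intro h
    obtain ⟨t, ht, htn⟩ := Set.exists_subset_encard_eq h
    have hfin : t.Finite := Set.finite_of_encard_eq_coe htn
    have := hfin.to_subtype
    have hcard : Nat.card t = n := by
      rw [Nat.card_coe_set_eq, Set.ncard, htn, ENat.toNat_natCast]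
    refine ⟨fun j => ((Finite.equivFinOfCardEq hcard).symm j : α), ?_,
      fun j => ht (Subtype.property _)⟩
    exact Subtype.val_injective.comp (Equiv.injective _)
  · rintro ⟨f, hf, hX⟩
    calc (n : ℕ∞) = (Set.range f).encard := by
          rw [← Set.image_univ, hf.encard_image]; simp
      _ ≤ X.encard := Set.encard_le_encard (by rintro _ ⟨j, rfl⟩; exact hX j)

/-! ### Algebraic elements and automorphisms of ultraproducts -/

section Ultraproducts

variable {S : Type u} {L : Language S} {I : Type u} (U : Ultrafilter I) {M : S → Type u}
  {s : S}

/-- The ultraproduct of sets of elements of one sort. -/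
def ultraSet (X : I → Set (M s)) : Set (Ultrapower U M s) :=
  {x | ∃ a : I → M s, x = (a : Ultrapower U M s) ∧ ∀ᶠ i in (U : Filter I), a i ∈ X i}

variable {U}

theorem coe_mem_ultraSet {X : I → Set (M s)} {a : I → M s} :
    (a : Ultrapower U M s) ∈ ultraSet U X ↔ ∀ᶠ i in (U : Filter I), a i ∈ X i := by
  constructor
  · rintro ⟨a', h, ha'⟩
    filter_upwards [Filter.Germ.coe_eq.1 h, ha'] with i hi hi'
    rwa [hi]
  · exact fun h => ⟨a, rfl, h⟩

theorem coe_mem_ultraproduct {F : I → ∀ s, Set (M s)} {a : I → M s} :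
    (a : Ultrapower U M s) ∈ ultraproduct U F s ↔ ∀ᶠ i in (U : Filter I), a i ∈ F i s :=
  coe_mem_ultraSet (X := fun i => F i s)

/-- If the left side fails, counterexamples exist at almost every coordinate and form a single
sequence violating the right side. -/
theorem eventually_forall_mem_iff {X : I → Set (M s)} {P : ∀ _ : I, M s → Prop} :
    (∀ᶠ i in (U : Filter I), ∀ x ∈ X i, P i x) ↔
      ∀ a : I → M s, (∀ᶠ i in (U : Filter I), a i ∈ X i) → ∀ᶠ i in (U : Filter I), P i (a i) := by
  constructor
  · intro h a ha
    filter_upwards [h, ha] with i hi hi'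
    exact hi _ hi'
  · intro h
    by_contra hn
    rw [← Ultrafilter.eventually_not] at hn
    simp only [not_forall] at hn
    obtain ⟨a, ha⟩ := exists_seq_const U hn
    have := h a (ha.mono fun i hi => hi.choose)
    obtain ⟨i, h₁, h₂⟩ := (ha.and this).exists
    exact h₁.choose_spec h₂

theorem natCast_le_encard_ultraSet {X : I → Set (M s)} {n : ℕ} :
    (n : ℕ∞) ≤ (ultraSet U X).encard ↔ ∀ᶠ i in (U : Filter I), (n : ℕ∞) ≤ (X i).encard := by
  constructor
  · intro h
    obtain ⟨f, hf, hX⟩ := natCast_le_encard_iff.1 h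
    choose a ha using fun j => exists_coe U (f j)
    have h₁ : ∀ᶠ i in (U : Filter I), ∀ j, a j i ∈ X i :=
      Filter.eventually_all.2 fun j => coe_mem_ultraSet.1 ((ha j).symm ▸ hX j)
    have h₂ : ∀ᶠ i in (U : Filter I), ∀ p : Fin n × Fin n, p.1 ≠ p.2 → a p.1 i ≠ a p.2 i := by
      refine Filter.eventually_all.2 fun p => Filter.eventually_imp_distrib_left.2 fun hp => ?_
      rw [Ultrafilter.eventually_not]
      intro heq
      refine hp (hf ?_)
      rw [← ha, ← ha]
      exact Filter.Germ.coe_eq.2 heq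
    filter_upwards [h₁, h₂] with i hi hi'
    refine natCast_le_encard_iff.2 ⟨fun j => a j i, fun j k hjk => ?_, hi⟩
    by_contra hne
    exact hi' (j, k) hne hjk
  · intro h
    simp only [natCast_le_encard_iff] at h
    obtain ⟨f, hf⟩ := exists_seq_const U h
    refine natCast_le_encard_iff.2 ⟨fun j => ((fun i => f i j : I → M s) : Ultrapower U M s),
      fun j k hjk => ?_, fun j => coe_mem_ultraSet.2 (hf.mono fun i hi => hi.2 j)⟩
    obtain ⟨i, h₁, h₂⟩ := (hf.and (Filter.Germ.coe_eq.1 hjk)).exists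
    exact h₁.1 h₂

theorem eventually_encard_le {X : I → Set (M s)} {n : ℕ} :
    (∀ᶠ i in (U : Filter I), (X i).encard ≤ n) ↔ (ultraSet U X).encard ≤ n := by
  have h : ∀ Y : ℕ∞, Y ≤ n ↔ ¬ ((n + 1 : ℕ) : ℕ∞) ≤ Y := by
    intro Y
    rw [not_le, Nat.cast_add, Nat.cast_one, ENat.lt_natCast_add_one_iff]
  simp only [h]
  rw [natCast_le_encard_ultraSet, Ultrafilter.eventually_not]

theorem exists_seq_tuple {F : I → ∀ s, Set (M s)} {Γ : List S} {b : Tuple (Ultrapower U M) Γ}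
    (hb : ∀ s i, b s i ∈ ultraproduct U F s) :
    ∃ w : I → Tuple M Γ, ultraTuple U w = b ∧
      ∀ᶠ i in (U : Filter I), ∀ s j, w i s j ∈ F i s := by
  obtain ⟨w, rfl⟩ := exists_ultraTuple U b
  refine ⟨w, rfl, ?_⟩
  filter_upwards [Filter.eventually_all.2 fun p : Σ s, Var Γ s =>
    coe_mem_ultraproduct.1 (hb p.1 p.2)] with i hi s j
  exact hi ⟨s, j⟩

variable [Structure L M] {F : I → ∀ s, Set (M s)}

/-- An algebraic element of an ultraproduct is the class of a sequence of algebraic elements of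
bounded degree. -/
theorem exists_bound_of_mem_acl {a : I → M s}
    (ha : (a : Ultrapower U M s) ∈ acl L (ultraproduct U F) s) :
    ∃ (n : ℕ) (Δ : List S) (φ : Formula L (s :: Δ)) (w : I → Tuple M Δ),
      ∀ᶠ i in (U : Filter I), (∀ t j, w i t j ∈ F i t) ∧ φ.Realize (Tuple.cons (a i) (w i)) ∧
        {y | φ.Realize (Tuple.cons y (w i))}.encard ≤ n := by
  obtain ⟨Δ, φ, b, hb, hx, hfin⟩ := ha
  obtain ⟨w, rfl, hw⟩ := exists_seq_tuple hb
  rw [← ultraTuple_cons, Formula.realize_ultraTuple] at hx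
  have heq : ultraSet U (fun i => {y | φ.Realize (Tuple.cons y (w i))}) =
      {y | φ.Realize (Tuple.cons y (ultraTuple U w))} := by
    ext y
    obtain ⟨c, rfl⟩ := exists_coe U y
    rw [coe_mem_ultraSet]
    simp only [Set.mem_ofPred_eq]
    rw [← ultraTuple_cons, Formula.realize_ultraTuple]
  obtain ⟨n, hn⟩ := hfin.encard_lt_top.ne |> ENat.ne_top_iff_exists.1
  have hle : (ultraSet U (fun i => {y | φ.Realize (Tuple.cons y (w i))})).encard ≤ n := by
    rw [heq, hn]
  refine ⟨n, Δ, φ, w, ?_⟩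
  filter_upwards [hw, hx, eventually_encard_le.2 hle] with i h₁ h₂ h₃
  exact ⟨h₁, h₂, h₃⟩

theorem eventually_mem_acl {a : I → M s}
    (ha : (a : Ultrapower U M s) ∈ acl L (ultraproduct U F) s) :
    ∀ᶠ i in (U : Filter I), a i ∈ acl L (F i) s := by
  obtain ⟨n, Δ, φ, w, h⟩ := exists_bound_of_mem_acl ha
  filter_upwards [h] with i hi
  exact ⟨Δ, φ, w i, hi.1, hi.2.1, Set.encard_lt_top_iff.1 (hi.2.2.trans_lt (by simp))⟩

variable {T : Theory L} (hQE : T.HasQE) (hM : T.IsModel M)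

-- The orbit stays among the solutions of the formula witnessing algebraicity, whose parameters lie
-- in `F i`. With `mem_acl_ultraproduct` as converse, algebraicity over the ultraproduct means
-- having orbits of bounded size.
include hQE hM in
theorem exists_bound_orbit {a : I → M s}
    (ha : (a : Ultrapower U M s) ∈ acl L (ultraproduct U F) s) :
    ∃ n : ℕ, ∀ᶠ i in (U : Filter I),
      (Set.range fun σ : AbsGal L (F i) => AbsGal.ext s σ (a i)).encard ≤ n := by
  obtain ⟨n, Δ, φ, w, h⟩ := exists_bound_of_mem_acl ha
  refine ⟨n, ?_⟩
  filter_upwards [h, eventually_mem_acl ha] with i hi hai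
  refine (Set.encard_le_encard ?_).trans hi.2.2
  rintro _ ⟨σ, rfl⟩
  exact (σ.realize_cons_ext hQE hM hai hi.1 φ).2 hi.2.1

theorem coe_ext_congr {σ : ∀ i, AbsGal L (F i)} {a a' : I → M s}
    (h : (a : Ultrapower U M s) = (a' : Ultrapower U M s)) :
    ((fun i => AbsGal.ext s (σ i) (a i) : I → M s) : Ultrapower U M s) =
      ((fun i => AbsGal.ext s (σ i) (a' i) : I → M s) : Ultrapower U M s) :=
  Filter.Germ.coe_eq.2 ((Filter.Germ.coe_eq.1 h).mono fun i hi => by simp only [hi])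

-- By Łoś the coordinatewise action is an elementary relation on the algebraic elements, and it is
-- the identity on the ultraproduct; it therefore extends to an automorphism.
include hQE hM in
theorem exists_ulim_apply (σ : ∀ i, AbsGal L (F i)) :
    ∃ τ : AbsGal L (ultraproduct U F), ∀ s (a : I → M s),
      (a : Ultrapower U M s) ∈ acl L (ultraproduct U F) s →
      AbsGal.ext s τ (a : Ultrapower U M s) =
        ((fun i => AbsGal.ext s (σ i) (a i) : I → M s) : Ultrapower U M s) := by
  let R : Set (Σ s, Ultrapower U M s × Ultrapower U M s) :=
    {p | p.2.1 ∈ acl L (ultraproduct U F) p.1 ∧ ∀ a : I → M p.1,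
      (a : Ultrapower U M p.1) = p.2.1 →
      p.2.2 = ((fun i => AbsGal.ext p.1 (σ i) (a i) : I → M p.1) : Ultrapower U M p.1)}
  have hR : IsElementary L R := by
    intro Γ x y h φ hx
    obtain ⟨w, rfl⟩ := exists_ultraTuple U x
    have hy : y = ultraTuple U (fun i s j => AbsGal.ext s (σ i) (w i s j)) := by
      funext s j
      exact (h s j).2 (fun i => w i s j) rfl
    rw [hy, Formula.realize_ultraTuple]
    rw [Formula.realize_ultraTuple] at hx
    have hacl : ∀ᶠ i in (U : Filter I), ∀ p : Σ s, Var Γ s, w i p.1 p.2 ∈ acl L (F i) p.1 :=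
      Filter.eventually_all.2 fun p => eventually_mem_acl (h p.1 p.2).1
    filter_upwards [hx, hacl] with i hi hi'
    exact ((σ i).realize_ext hQE hM (w i) (fun s j => hi' ⟨s, j⟩) φ).2 hi
  obtain ⟨τ, hτ⟩ := hR.exists_absGal (A := ultraproduct U F) (fun p hp => hp.1) (by
    intro s x hx
    refine ⟨subset_acl s hx, fun a ha => ?_⟩
    simp only at ha ⊢
    rw [← ha]
    refine Filter.Germ.coe_eq.2 ?_
    filter_upwards [coe_mem_ultraproduct.1 (ha.symm ▸ hx)] with i hi
    exact ((σ i).ext_of_mem_dcl (subset_dcl s hi)).symm)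
  exact ⟨τ, fun s a ha => hτ s _ _ ⟨ha, fun a' ha' => coe_ext_congr ha'.symm⟩⟩

variable (U F) in
/-- The ultralimit of a sequence of automorphisms. -/
def ulim : (∀ i, AbsGal L (F i)) →* AbsGal L (ultraproduct U F) :=
  MonoidHom.mk' (fun σ => (exists_ulim_apply hQE hM σ).choose) (by
    intro σ τ
    refine AbsGal.eq_of_ext fun s x hx => ?_
    obtain ⟨a, rfl⟩ := exists_coe U x
    have hτ := (exists_ulim_apply hQE hM τ).choose_spec s a hx
    rw [(exists_ulim_apply hQE hM (σ * τ)).choose_spec s a hx, AbsGal.ext_mul, hτ,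
      (exists_ulim_apply hQE hM σ).choose_spec s _ (hτ ▸ AbsGal.ext_mem _ hx)]
    simp only [Pi.mul_apply, AbsGal.ext_mul])

theorem ext_ulim (σ : ∀ i, AbsGal L (F i)) {s : S} {a : I → M s}
    (ha : (a : Ultrapower U M s) ∈ acl L (ultraproduct U F) s) :
    AbsGal.ext s (ulim U F hQE hM σ) (a : Ultrapower U M s) =
      ((fun i => AbsGal.ext s (σ i) (a i) : I → M s) : Ultrapower U M s) :=
  (exists_ulim_apply hQE hM σ).choose_spec s a ha

include hQE hM in
theorem fixes_ulim_iff {σ : ∀ i, AbsGal L (F i)} {X : I → Set (M s)}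
    (hX : ultraSet U X ⊆ acl L (ultraproduct U F) s) :
    (∀ x ∈ ultraSet U X, AbsGal.ext s (ulim U F hQE hM σ) x = x) ↔
      ∀ᶠ i in (U : Filter I), ∀ x ∈ X i, AbsGal.ext s (σ i) x = x := by
  rw [eventually_forall_mem_iff]
  constructor
  · intro h a ha
    have ha' := coe_mem_ultraSet.2 ha
    have := h _ ha'
    rw [ext_ulim _ _ _ (hX ha')] at this
    exact Filter.Germ.coe_eq.1 this
  · intro h x hx
    obtain ⟨a, rfl⟩ := exists_coe U x
    rw [ext_ulim _ _ _ (hX hx)]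
    exact Filter.Germ.coe_eq.2 (h a (coe_mem_ultraSet.1 hx))

include hQE hM in
/-- The class of a sequence of elements whose orbits have bounded size is algebraic. -/
theorem mem_acl_ultraproduct (hEI : T.HasEI) (hF : ∀ i, IsDefinablyClosed L (F i)) {a : I → M s}
    (ha : ∀ᶠ i in (U : Filter I), a i ∈ acl L (F i) s) {n : ℕ}
    (hn : ∀ᶠ i in (U : Filter I),
      (Set.range fun σ : AbsGal L (F i) => AbsGal.ext s σ (a i)).encard ≤ n) :
    (a : Ultrapower U M s) ∈ acl L (ultraproduct U F) s := by
  let X : I → Set (M s) := fun i => Set.range fun σ : AbsGal L (F i) => AbsGal.ext s σ (a i)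
  have haX : (a : Ultrapower U M s) ∈ ultraSet U X :=
    coe_mem_ultraSet.2 (Filter.Eventually.of_forall fun i => ⟨1, AbsGal.ext_one _ _⟩)
  have hfin : (ultraSet U X).Finite :=
    Set.encard_lt_top_iff.1 ((eventually_encard_le.1 hn).trans_lt (by simp))
  obtain ⟨Γ, e, hinj, he⟩ := exists_enumeration (hfin.image (Sigma.mk s))
  have hsort : ∀ t (j : Var Γ t), t = s := by
    intro t j
    obtain ⟨x, -, hx⟩ := (he t (e t j)).2 ⟨j, rfl⟩
    exact (congrArg Sigma.fst hx).symm
  have he' : ∀ x, x ∈ ultraSet U X ↔ ∃ j, e s j = x := by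
    intro x
    rw [← he]
    simp
  obtain ⟨w, rfl⟩ := exists_ultraTuple U e
  -- The full permutation group is used, so `b` codes the set of all enumerations of the limit of
  -- the orbits. By Łoś, the same formula `ψ` codes the orbits at almost all coordinates.
  obtain ⟨Λ, ψ, b, hb⟩ := hEI.exists_isCode (hM.ultrapower U)
    (⊤ : Subgroup (∀ s, Equiv.Perm (Var Γ s))) (ultraTuple U w)
  obtain ⟨v, rfl⟩ := exists_ultraTuple U b
  obtain ⟨ξ, hξ⟩ := exists_formula_isCode (L := L) ⊤ ψ
  have hcode : ∀ᶠ i in (U : Filter I), IsCode ⊤ ψ (w i) (v i) := by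
    have := (hξ _ _ _).2 hb
    rw [← ultraTuple_append, Formula.realize_ultraTuple] at this
    exact this.mono fun i hi => (hξ _ _ _).1 hi
  have hwX : ∀ᶠ i in (U : Filter I), ∀ j : Var Γ s, w i s j ∈ X i :=
    Filter.eventually_all.2 fun j => coe_mem_ultraSet.1 ((he' _).2 ⟨j, rfl⟩)
  have hXw : ∀ᶠ i in (U : Filter I), ∀ x ∈ X i, ∃ j, w i s j = x := by
    rw [eventually_forall_mem_iff]
    intro c hc
    obtain ⟨j, hj⟩ := (he' _).1 (coe_mem_ultraSet.2 hc)
    filter_upwards [Filter.Germ.coe_eq.1 hj] with i hi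
    exact ⟨j, hi⟩
  have hwinj : ∀ᶠ i in (U : Filter I), ∀ p : Var Γ s × Var Γ s,
      w i s p.1 = w i s p.2 → p.1 = p.2 := by
    refine Filter.eventually_all.2 fun p => ?_
    by_cases hp : p.1 = p.2
    · exact Filter.Eventually.of_forall fun _ _ => hp
    · have : ∀ᶠ i in (U : Filter I), ¬ w i s p.1 = w i s p.2 := by
        rw [Ultrafilter.eventually_not]
        exact fun h => hp (hinj s (Filter.Germ.coe_eq.2 h))
      exact this.mono fun i hi h => absurd h hi
  -- An automorphism only permutes the orbit of `a i`, so it fixes the code `v i`, which therefore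
  -- lies in the definably closed set `F i`.
  have hv : ∀ᶠ i in (U : Filter I), ∀ t j, v i t j ∈ F i t := by
    filter_upwards [hcode, hwX, hXw, hwinj, ha] with i hcode hwX hXw hwinj ha t j
    have hwacl : ∀ t j, w i t j ∈ acl L (F i) t := by
      intro t j
      obtain rfl := hsort t j
      obtain ⟨σ, hσ⟩ := hwX j
      rw [← hσ]
      exact σ.ext_mem ha
    refine hF i t (mem_dcl_of_forall_fixed (hcode.mem_acl hwacl t j) fun σ => ?_)
    obtain ⟨r, hr⟩ := exists_perm_of_invariant (e := w i) (fun t j k h => by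
      obtain rfl := hsort t j
      exact hwinj (j, k) h) (fun t => AbsGal.ext t σ) (fun t j => by
      obtain rfl := hsort t j
      obtain ⟨τ, hτ⟩ := hwX j
      refine hXw _ ⟨σ * τ, ?_⟩
      rw [← hτ]
      exact AbsGal.ext_mul _ _ _ _)
    have h := hcode.ext hQE hM σ hwacl
    have heq : (fun t j => AbsGal.ext t σ (w i t j)) = (w i).sub (fun t j => r t j) := by
      funext t j; exact hr t j
    rw [heq] at h
    exact congrFun (congrFun (hcode.eq (h.of_sub trivial)) t) j
  obtain ⟨j, hj⟩ := (he' _).1 haX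
  rw [← hj]
  -- The formula `ψ` now has parameters in the ultraproduct, and its solutions are the finitely many
  -- permutations of the enumeration.
  refine mem_acl_of_tuple ψ (b := ultraTuple U v) (fun t k => coe_mem_ultraproduct.2
    (hv.mono fun i hi => hi t k)) ((hb.1 _).1 ⟨1, trivial, rfl⟩) ?_ s j
  simp only [← hb.1]
  refine (Set.finite_range fun r : ∀ s, Equiv.Perm (Var Γ s) =>
    (ultraTuple U w).sub (fun s i => r s i)).subset ?_
  rintro _ ⟨r, -, rfl⟩
  exact ⟨r, rfl⟩

/-- The ultralimits are dense in `𝒢(∏_U F_i)`. -/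
theorem exists_ulim_eqOn (hEI : T.HasEI) (hF : ∀ i, IsDefinablyClosed L (F i))
    (τ : AbsGal L (ultraproduct U F)) {C : Set (Σ s, Ultrapower U M s)} (hC : C.Finite)
    (hCA : ∀ p ∈ C, p.2 ∈ acl L (ultraproduct U F) p.1) :
    ∃ σ : ∀ i, AbsGal L (F i), ∀ p ∈ C,
      AbsGal.ext p.1 (ulim U F hQE hM σ) p.2 = AbsGal.ext p.1 τ p.2 := by
  obtain ⟨_, ⟨σ, rfl⟩, hσ⟩ := exists_mem_eqOn_of_fixes hQE (hM.ultrapower U) hEI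
    (ulim U F hQE hM).range τ (by
      intro s x hx
      obtain ⟨hxacl, hx⟩ := mem_fixedPoints.1 hx
      obtain ⟨a, rfl⟩ := exists_coe U x
      refine τ.ext_of_mem_dcl (subset_dcl s (coe_mem_ultraproduct.2 ?_))
      -- Otherwise automorphisms moving `a i` could be chosen for almost all `i`, and their
      -- ultralimit would move the class of `a`, which is fixed by all ultralimits.
      have hfix : ∀ᶠ i in (U : Filter I), ∀ σ : AbsGal L (F i), AbsGal.ext s σ (a i) = a i := by
        by_contra hn
        rw [← Ultrafilter.eventually_not] at hn
        simp only [not_forall] at hn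
        obtain ⟨σ, hσ⟩ := exists_seq U hn
        have := hx _ ⟨σ, rfl⟩
        rw [ext_ulim _ _ _ hxacl] at this
        obtain ⟨i, h₁, h₂⟩ := (hσ.and (Filter.Germ.coe_eq.1 this)).exists
        exact h₁ h₂
      filter_upwards [hfix, eventually_mem_acl hxacl] with i hi hi'
      exact hF i s (mem_dcl_of_forall_fixed hi' hi)) hC hCA
  exact ⟨σ, hσ⟩

end Ultraproducts

/-! ### Gluing two dense homomorphisms that control each other -/

section Glue

variable {S : Type u} {L : Language S} {N : S → Type u} [Structure L N]
  {A B : ∀ s, Set (N s)} {P : Type*} [Group P]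

/-- The image of `l` is dense in `𝒢(A)`. -/
def IsDenseHom (l : P →* AbsGal L A) : Prop :=
  ∀ (τ : AbsGal L A) (C : Set (Σ s, N s)), C.Finite → (∀ p ∈ C, p.2 ∈ acl L A p.1) →
    ∃ σ : P, ∀ p ∈ C, AbsGal.ext p.1 (l σ) p.2 = AbsGal.ext p.1 τ p.2

/-- Every element `y` of `acl(B)` belongs to a finite subset of its orbit, which is fixed by
`k(σ)` if and only if `l(σ)` fixes a certain finite set of elements of `acl(A)` of the same
sort. -/
def Controls (l : P →* AbsGal L A) (k : P →* AbsGal L B) : Prop :=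
  ∀ (s : S), ∀ y ∈ acl L B s, ∃ C Y : Set (N s), C.Finite ∧ C ⊆ acl L A s ∧ Y.Finite ∧
    y ∈ Y ∧ (∀ z ∈ Y, ∃ ρ : AbsGal L B, AbsGal.ext s ρ y = z) ∧
    ∀ σ : P, (∀ x ∈ C, AbsGal.ext s (l σ) x = x) ↔ ∀ z ∈ Y, AbsGal.ext s (k σ) z = z

/-- `(τ, ρ)` is in the closure of the set of the pairs `(l(σ), k(σ))`. -/
def Approx (l : P →* AbsGal L A) (k : P →* AbsGal L B) (τ : AbsGal L A) (ρ : AbsGal L B) : Prop :=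
  ∀ C D : Set (Σ s, N s), C.Finite → D.Finite → (∀ p ∈ C, p.2 ∈ acl L A p.1) →
    (∀ p ∈ D, p.2 ∈ acl L B p.1) → ∃ σ : P,
      (∀ p ∈ C, AbsGal.ext p.1 (l σ) p.2 = AbsGal.ext p.1 τ p.2) ∧
      ∀ p ∈ D, AbsGal.ext p.1 (k σ) p.2 = AbsGal.ext p.1 ρ p.2

/-- The action on elements of all sorts. -/
def AbsGal.extSigma (σ : AbsGal L A) (p : Σ s, N s) : Σ s, N s := ⟨p.1, AbsGal.ext p.1 σ p.2⟩

variable {l : P →* AbsGal L A} {k : P →* AbsGal L B}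

theorem Approx.swap {τ : AbsGal L A} {ρ : AbsGal L B} (h : Approx l k τ ρ) : Approx k l ρ τ :=
  fun C D hC hD hCA hDB => (h D C hD hC hDB hCA).imp fun _ hσ => hσ.symm

theorem Approx.of_apply (σ : P) : Approx l k (l σ) (k σ) :=
  fun _ _ _ _ _ _ => ⟨σ, fun _ _ => rfl, fun _ _ => rfl⟩

theorem Approx.mul {τ τ' : AbsGal L A} {ρ ρ' : AbsGal L B} (h : Approx l k τ ρ)
    (h' : Approx l k τ' ρ') : Approx l k (τ * τ') (ρ * ρ') := by
  intro C D hC hD hCA hDB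
  obtain ⟨σ', h₁', h₂'⟩ := h' C D hC hD hCA hDB
  obtain ⟨σ, h₁, h₂⟩ := h (AbsGal.extSigma τ' '' C)
    (AbsGal.extSigma ρ' '' D) (hC.image _) (hD.image _)
    (by rintro _ ⟨p, hp, rfl⟩; exact τ'.ext_mem (hCA p hp))
    (by rintro _ ⟨p, hp, rfl⟩; exact ρ'.ext_mem (hDB p hp))
  refine ⟨σ * σ', fun p hp => ?_, fun p hp => ?_⟩
  · rw [map_mul, AbsGal.ext_mul, AbsGal.ext_mul, h₁' p hp]
    exact h₁ _ ⟨p, hp, rfl⟩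
  · rw [map_mul, AbsGal.ext_mul, AbsGal.ext_mul, h₂' p hp]
    exact h₂ _ ⟨p, hp, rfl⟩

theorem Approx.inv {τ : AbsGal L A} {ρ : AbsGal L B} (h : Approx l k τ ρ) :
    Approx l k τ⁻¹ ρ⁻¹ := by
  intro C D hC hD hCA hDB
  obtain ⟨σ, h₁, h₂⟩ := h (AbsGal.extSigma τ⁻¹ '' C)
    (AbsGal.extSigma ρ⁻¹ '' D) (hC.image _) (hD.image _)
    (by rintro _ ⟨p, hp, rfl⟩; exact τ⁻¹.ext_mem (hCA p hp))
    (by rintro _ ⟨p, hp, rfl⟩; exact ρ⁻¹.ext_mem (hDB p hp))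
  refine ⟨σ⁻¹, fun p hp => ?_, fun p hp => ?_⟩
  · rw [map_inv, AbsGal.ext_inv_eq_iff]
    exact ((h₁ _ ⟨p, hp, rfl⟩).trans τ.ext_ext_inv).symm
  · rw [map_inv, AbsGal.ext_inv_eq_iff]
    exact ((h₂ _ ⟨p, hp, rfl⟩).trans ρ.ext_ext_inv).symm

/-- The equivalence involves only the finitely many elements of `C` and `Y`, so it passes from the
pairs `(l σ, k σ)` to their closure. -/
theorem Controls.exists_approx (h : Controls l k) {s : S} {y : N s} (hy : y ∈ acl L B s) :
    ∃ C Y : Set (N s), C.Finite ∧ C ⊆ acl L A s ∧ y ∈ Y ∧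
      (∀ z ∈ Y, ∃ ρ : AbsGal L B, AbsGal.ext s ρ y = z) ∧ ∀ τ ρ, Approx l k τ ρ →
      ((∀ x ∈ C, AbsGal.ext s τ x = x) ↔ ∀ z ∈ Y, AbsGal.ext s ρ z = z) := by
  obtain ⟨C, Y, hC, hCA, hY, hyY, horb, hiff⟩ := h s y hy
  refine ⟨C, Y, hC, hCA, hyY, horb, fun τ ρ hτρ => ?_⟩
  obtain ⟨σ, h₁, h₂⟩ := hτρ (Sigma.mk s '' C) (Sigma.mk s '' Y) (hC.image _) (hY.image _)
    (by rintro _ ⟨x, hx, rfl⟩; exact hCA hx)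
    (by rintro _ ⟨z, hz, rfl⟩
        obtain ⟨ρ, rfl⟩ := horb z hz
        exact ρ.ext_mem hy)
  have h₁' : ∀ x ∈ C, AbsGal.ext s (l σ) x = AbsGal.ext s τ x := fun x hx => h₁ _ ⟨x, hx, rfl⟩
  have h₂' : ∀ z ∈ Y, AbsGal.ext s (k σ) z = AbsGal.ext s ρ z := fun x hx => h₂ _ ⟨x, hx, rfl⟩
  have e₁ : (∀ x ∈ C, AbsGal.ext s (l σ) x = x) ↔ ∀ x ∈ C, AbsGal.ext s τ x = x :=
    forall₂_congr fun x hx => by rw [h₁' x hx]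
  have e₂ : (∀ z ∈ Y, AbsGal.ext s (k σ) z = z) ↔ ∀ z ∈ Y, AbsGal.ext s ρ z = z :=
    forall₂_congr fun x hx => by rw [h₂' x hx]
  rw [← e₁, hiff σ, e₂]

/-- The identity fixes every control set, hence so does its partner. As the closure is stable under
products and inverses, this makes it single-valued. -/
theorem Approx.eq_one (h : Controls l k) {ρ : AbsGal L B} (hρ : Approx l k 1 ρ) : ρ = 1 := by
  refine AbsGal.eq_of_ext fun s y hy => ?_
  obtain ⟨C, Y, -, -, hyY, -, hiff⟩ := h.exists_approx hy
  rw [AbsGal.ext_one]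
  exact (hiff 1 ρ hρ).1 (fun x _ => AbsGal.ext_one s x) y hyY

theorem Approx.eq (h : Controls l k) {τ : AbsGal L A} {ρ ρ' : AbsGal L B} (hρ : Approx l k τ ρ)
    (hρ' : Approx l k τ ρ') : ρ = ρ' := by
  have := hρ.inv.mul hρ'
  rw [inv_mul_cancel] at this
  exact inv_mul_eq_one.1 (this.eq_one h)

theorem AbsGal.continuous_of_forall {f : AbsGal L A →* AbsGal L B}
    (h : ∀ s, ∀ y ∈ acl L B s, ∃ C : Set (Σ s, N s), C.Finite ∧ (∀ p ∈ C, p.2 ∈ acl L A p.1) ∧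
      ∀ τ : AbsGal L A, (∀ p ∈ C, ext p.1 τ p.2 = p.2) → ext s (f τ) y = y) : Continuous f := by
  refine continuous_generateFrom_iff.2 ?_
  rintro _ ⟨s, x, y, rfl⟩
  rw [AbsGal.isOpen_iff]
  intro τ hτ
  obtain ⟨C, hC, hCA, hfix⟩ := h s x x.2
  refine ⟨C, hC, hCA, fun τ' hτ' => ?_⟩
  have := hfix (τ⁻¹ * τ') fun p hp => by rw [ext_mul, hτ' p hp, ext_inv_ext]
  rw [map_mul, map_inv, ext_mul, ext_inv_eq_iff, ext_of_mem _ x.2, ext_of_mem _ x.2] at this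
  exact (Subtype.ext this).trans hτ

variable {T : Theory L} (hQE : T.HasQE) (hN : T.IsModel N)

include hQE hN in
/-- A map which agrees with elements of `𝒢(A)` on the finite subsets of `acl(A)` is itself in
`𝒢(A)`. -/
theorem exists_absGal_of_locally (g : ∀ s, N s → N s)
    (hg : ∀ C : Set (Σ s, N s), C.Finite → (∀ p ∈ C, p.2 ∈ acl L A p.1) →
      ∃ σ : AbsGal L A, ∀ p ∈ C, AbsGal.ext p.1 σ p.2 = g p.1 p.2) :
    ∃ σ : AbsGal L A, ∀ s, ∀ x ∈ acl L A s, AbsGal.ext s σ x = g s x := by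
  have hR : IsElementary L {p : Σ s, N s × N s | p.2.1 ∈ acl L A p.1 ∧ g p.1 p.2.1 = p.2.2} := by
    intro Γ u v h φ hu
    obtain ⟨σ, hσ⟩ := hg (Set.range fun p : Σ s, Var Γ s => ⟨p.1, u p.1 p.2⟩)
      (Set.finite_range _) (by rintro _ ⟨p, rfl⟩; exact (h p.1 p.2).1)
    have := (σ.realize_ext hQE hN u (fun s i => (h s i).1) φ).2 hu
    convert this using 1
    funext s i
    exact ((hσ _ ⟨⟨s, i⟩, rfl⟩).trans (h s i).2).symm
  obtain ⟨σ, hσ⟩ := hR.exists_absGal (A := A) (fun p hp => hp.1) (by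
    intro s a ha
    obtain ⟨σ, hσ⟩ := hg {⟨s, a⟩} (Set.finite_singleton _) (by
      rintro _ rfl; exact subset_acl s ha)
    refine ⟨subset_acl s ha, ?_⟩
    rw [← σ.ext_of_mem_dcl (subset_dcl s ha)]
    simpa [σ.ext_of_mem_dcl (subset_dcl s ha)] using (hσ _ rfl).symm)
  exact ⟨σ, fun s x hx => hσ s _ _ ⟨hx, rfl⟩⟩

-- Two `σ` for which `l σ` agrees with `τ` on the control set of `y` send `y` to the same point
-- under `k`. These common values, which by density of `l` are realized on any finite set by a
-- single `k σ`, define `ρ`.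
include hQE hN in
theorem Controls.exists_approx_right (h : Controls l k) (hl : IsDenseHom l) (τ : AbsGal L A) :
    ∃ ρ, Approx l k τ ρ := by
  have key : ∀ p : Σ s, N s, ∃ (C : Set (Σ s, N s)) (y : N p.1), C.Finite ∧
      (∀ q ∈ C, q.2 ∈ acl L A q.1) ∧ (p.2 ∈ acl L B p.1 → ∀ σ : P,
      (∀ q ∈ C, AbsGal.ext q.1 (l σ) q.2 = AbsGal.ext q.1 τ q.2) →
        AbsGal.ext p.1 (k σ) p.2 = y) := by
    intro p
    by_cases hp : p.2 ∈ acl L B p.1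
    · obtain ⟨C, Y, hC, hCA, -, hpY, -, hiff⟩ := h p.1 p.2 hp
      have hCA' : ∀ q ∈ Sigma.mk p.1 '' C, q.2 ∈ acl L A q.1 := by
        rintro _ ⟨x, hx, rfl⟩; exact hCA hx
      obtain ⟨σ₀, hσ₀⟩ := hl τ _ (hC.image (Sigma.mk p.1)) hCA'
      refine ⟨_, AbsGal.ext p.1 (k σ₀) p.2, hC.image (Sigma.mk p.1), hCA', fun _ σ hσ => ?_⟩
      have := (hiff (σ₀⁻¹ * σ)).1 (fun x hx => by
        have h₁ := hσ _ ⟨x, hx, rfl⟩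
        have h₂ := hσ₀ _ ⟨x, hx, rfl⟩
        simp only at h₁ h₂
        rw [map_mul, map_inv, AbsGal.ext_mul, AbsGal.ext_inv_eq_iff, h₁, h₂]) p.2 hpY
      rwa [map_mul, map_inv, AbsGal.ext_mul, AbsGal.ext_inv_eq_iff] at this
    · exact ⟨∅, p.2, Set.finite_empty, by simp, fun hp' => absurd hp' hp⟩
  choose C g hC hCA hg using key
  have hloc : ∀ D E : Set (Σ s, N s), D.Finite → E.Finite → (∀ p ∈ D, p.2 ∈ acl L A p.1) →
      (∀ p ∈ E, p.2 ∈ acl L B p.1) → ∃ σ : P,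
      (∀ p ∈ D, AbsGal.ext p.1 (l σ) p.2 = AbsGal.ext p.1 τ p.2) ∧
      ∀ p ∈ E, AbsGal.ext p.1 (k σ) p.2 = g p := by
    intro D E hD hE hDA hEB
    obtain ⟨σ, hσ⟩ := hl τ (D ∪ ⋃ p ∈ E, C p) (hD.union (hE.biUnion fun p _ => hC p)) (by
      rintro q (hq | hq)
      · exact hDA q hq
      · simp only [Set.mem_iUnion] at hq
        obtain ⟨p, -, hq⟩ := hq
        exact hCA p q hq)
    refine ⟨σ, fun p hp => hσ p (Or.inl hp), fun p hp => hg p (hEB p hp) σ fun q hq =>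
      hσ q (Or.inr (Set.mem_biUnion hp hq))⟩
  obtain ⟨ρ, hρ⟩ := exists_absGal_of_locally (A := B) hQE hN (fun s y => g ⟨s, y⟩) (by
    intro E hE hEB
    obtain ⟨σ, -, hσ⟩ := hloc ∅ E Set.finite_empty hE (by simp) hEB
    exact ⟨k σ, hσ⟩)
  refine ⟨ρ, fun D E hD hE hDA hEB => ?_⟩
  obtain ⟨σ, h₁, h₂⟩ := hloc D E hD hE hDA hEB
  exact ⟨σ, h₁, fun p hp => by rw [h₂ p hp, hρ p.1 p.2 (hEB p hp)]⟩

-- Control sets stay in the sort of the controlled element. Hence fixing the sort `J` points of the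
-- preimage of `H` forces `f τ` to fixate those of `H`, and so to lie in `H`.
include hQE hN in
theorem isSorted_of_approx (hEI : T.HasEI) (h : Controls l k) {f : AbsGal L A →* AbsGal L B}
    (hfc : Continuous f) (hf : ∀ τ, Approx l k τ (f τ)) : IsSorted f := by
  intro H hHn hH J hcard
  rw [mk_autSort_eq_iff hQE hN hEI hHn hH] at hcard
  rw [mk_autSort_eq_iff hQE hN hEI (hHn.comap f) (hH.preimage hfc)]
  intro τ hτ
  refine hcard _ fun y hy => ?_
  obtain ⟨hyB, hy⟩ := mem_fixedPoints.1 hy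
  obtain ⟨C, Y, -, hCA, hyY, horb, hiff⟩ := h.exists_approx hyB
  refine (hiff τ _ (hf τ)).1
    (fun x hx => hτ x (mem_fixedPoints.2 ⟨hCA hx, fun τ' hτ' => ?_⟩)) y hyY
  refine (hiff τ' _ (hf τ')).2 (fun z hz => ?_) x hx
  obtain ⟨ρ, rfl⟩ := horb z hz
  -- The elements of `Y` are conjugates of `y`, so normality of `H` makes them fixed by `H` too;
  -- this puts `C` among the fixed points of the preimage.
  have := hy _ (hHn.conj_mem _ (Subgroup.mem_comap.1 hτ') ρ⁻¹)
  rwa [inv_inv, AbsGal.ext_mul, AbsGal.ext_mul, AbsGal.ext_inv_eq_iff] at this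

theorem continuous_of_approx (h : Controls l k) {f : AbsGal L A →* AbsGal L B}
    (hf : ∀ τ, Approx l k τ (f τ)) : Continuous f := by
  refine AbsGal.continuous_of_forall fun s y hy => ?_
  obtain ⟨C, Y, hC, hCA, hyY, -, hiff⟩ := h.exists_approx hy
  refine ⟨Sigma.mk s '' C, hC.image _, by rintro _ ⟨x, hx, rfl⟩; exact hCA hx, fun τ hτ => ?_⟩
  exact (hiff τ _ (hf τ)).1 (fun x hx => hτ _ ⟨x, hx, rfl⟩) y hyY

include hQE hN in
/-- Two homomorphisms with dense images which control each other induce a sorted isomorphism. -/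
theorem exists_sortedIso (hEI : T.HasEI) (hl : IsDenseHom l) (hk : IsDenseHom k)
    (hlk : Controls l k) (hkl : Controls k l) :
    ∃ Φ : AbsGal L A ≃ₜ* AbsGal L B, IsSortedIso Φ ∧ ∀ σ, Φ (l σ) = k σ := by
  choose f hf using hlk.exists_approx_right hQE hN hl
  choose g hg using hkl.exists_approx_right hQE hN hk
  let e : AbsGal L A ≃* AbsGal L B :=
    { toFun := f
      invFun := g
      left_inv := fun τ => (hg (f τ)).eq hkl (hf τ).swap
      right_inv := fun ρ => (hf (g ρ)).eq hlk (hg ρ).swap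
      map_mul' := fun τ τ' => (hf (τ * τ')).eq hlk ((hf τ).mul (hf τ')) }
  have he : ∀ τ, Approx l k τ ((e : AbsGal L A →* AbsGal L B) τ) := hf
  have he' : ∀ ρ, Approx k l ρ ((e.symm : AbsGal L B →* AbsGal L A) ρ) := hg
  have hc := continuous_of_approx hlk he
  have hc' := continuous_of_approx hkl he'
  refine ⟨{ e with continuous_toFun := hc, continuous_invFun := hc' }, ⟨?_, ?_⟩, fun σ => ?_⟩
  · exact isSorted_of_approx hQE hN hEI hlk hc he
  · exact isSorted_of_approx hQE hN hEI hkl hc' he'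
  · exact (hf (l σ)).eq hlk (Approx.of_apply σ)

end Glue

/-! ### Uniform bounds for a single sorted isomorphism -/

section Levels

variable {S : Type u} {L : Language S} {M : S → Type u} [Structure L M] {s : S}
  {T : Theory L} (hQE : T.HasQE) (hM : T.IsModel M)

/-- The pointwise stabilizer of the orbit of `d`. -/
def orbitFixer {A : ∀ s, Set (M s)} (d : M s) : Subgroup (AbsGal L A) where
  carrier := {τ | ∀ ρ : AbsGal L A, AbsGal.ext s τ (AbsGal.ext s ρ d) = AbsGal.ext s ρ d}
  one_mem' := fun _ => AbsGal.ext_one _ _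
  mul_mem' := fun {σ τ} hσ hτ ρ => by rw [AbsGal.ext_mul, hτ, hσ]
  inv_mem' := fun {σ} hσ ρ => by rw [AbsGal.ext_inv_eq_iff, hσ]

theorem orbitFixer_normal {A : ∀ s, Set (M s)} (d : M s) :
    (orbitFixer d : Subgroup (AbsGal L A)).Normal := by
  refine ⟨fun τ hτ σ ρ => ?_⟩
  rw [AbsGal.ext_mul, AbsGal.ext_mul, ← AbsGal.ext_mul σ⁻¹, hτ, ← AbsGal.ext_mul,
    mul_inv_cancel_left]

include hQE hM in
theorem isOpen_orbitFixer {A : ∀ s, Set (M s)} {d : M s} (hd : d ∈ acl L A s) :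
    IsOpen ((orbitFixer d : Subgroup (AbsGal L A)) : Set (AbsGal L A)) := by
  refine Subgroup.isOpen_iff_absGal.2
    ⟨_, (AbsGal.finite_orbit (A := A) hQE hM s d).image (Sigma.mk s), ?_, fun τ hτ ρ => ?_⟩
  · rintro _ ⟨_, ⟨ρ, rfl⟩, rfl⟩
    exact ρ.ext_mem hd
  · exact hτ _ ⟨_, ⟨ρ, rfl⟩, rfl⟩

-- The cosets act as distinct self-maps of an orbit of size at most `n`. The bound depends on `n`
-- alone, hence will be uniform over the index set of the ultraproduct.
include hQE hM in
theorem card_quotient_orbitFixer_le {A : ∀ s, Set (M s)} {d : M s} {n : ℕ}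
    (hn : (Set.range fun ρ : AbsGal L A => AbsGal.ext s ρ d).encard ≤ n) :
    ENat.card (AbsGal L A ⧸ (orbitFixer d : Subgroup (AbsGal L A))) ≤ (n ^ n : ℕ) := by
  let O := Set.range fun ρ : AbsGal L A => AbsGal.ext s ρ d
  have hfin : Finite O := (AbsGal.finite_orbit (A := A) hQE hM s d).to_subtype
  have hO : Nat.card O ≤ n := by
    rw [Nat.card_coe_set_eq]
    have := Set.toFinite O
    rw [← this.cast_ncard_eq] at hn
    exact_mod_cast hn
  -- Nonemptiness gives `1 ≤ n`, needed to enlarge the exponent from the size of the orbit to `n`.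
  have hpos : 0 < Nat.card O := Nat.card_pos_iff.2 ⟨⟨⟨_, 1, rfl⟩⟩, hfin⟩
  let f : (AbsGal L A ⧸ (orbitFixer d : Subgroup (AbsGal L A))) → O → O := fun q x =>
    ⟨AbsGal.ext s q.out x, by
      obtain ⟨ρ, hρ⟩ := x.2
      exact ⟨q.out * ρ, by rw [← hρ]; exact AbsGal.ext_mul _ _ _ _⟩⟩
  have hf : Function.Injective f := by
    intro q q' h
    rw [← q.out_eq, ← q'.out_eq]
    refine QuotientGroup.eq.2 fun ρ => ?_
    have := congrArg Subtype.val (congrFun h ⟨_, ρ, rfl⟩)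
    rw [AbsGal.ext_mul, AbsGal.ext_inv_eq_iff]
    exact this.symm
  have hq : Finite (AbsGal L A ⧸ (orbitFixer d : Subgroup (AbsGal L A))) := Finite.of_injective f hf
  rw [ENat.card_eq_coe_natCard]
  have hle := Nat.card_le_card_of_injective f hf
  rw [Nat.card_fun] at hle
  exact_mod_cast hle.trans ((Nat.pow_le_pow_left hO _).trans
    (Nat.pow_le_pow_right (hpos.trans_le hO) hO))

theorem encard_range_le {α β : Type*} (f : α → β) : (Set.range f).encard ≤ ENat.card α := by
  rw [← Set.image_univ, ← Set.encard_univ]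
  exact Set.encard_image_le _ _

/-- If the elements of sort `s` of `acl(A)^H` generate it, then boundedly many of them do. -/
theorem exists_generating {A : ∀ s, Set (M s)} {H : Subgroup (AbsGal L A)}
    (hgen : ∀ σ : AbsGal L A, (∀ x ∈ fixedPoints H s, AbsGal.ext s σ x = x) → σ ∈ H) :
    ∃ C : Set (M s), C ⊆ acl L A s ∧ C.encard ≤ ENat.card (AbsGal L A ⧸ H) ∧
      (∀ c ∈ C, (Set.range fun σ : AbsGal L A => AbsGal.ext s σ c).encard ≤
        ENat.card (AbsGal L A ⧸ H)) ∧
      ∀ σ : AbsGal L A, (∀ c ∈ C, AbsGal.ext s σ c = c) ↔ σ ∈ H := by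
  -- One moved point for each coset other than `H` is enough to detect `H`. Being fixed by `H`, each
  -- chosen point has an orbit no larger than the index.
  have hmoved : ∀ q : {q : AbsGal L A ⧸ H // q.out ∉ H},
      ∃ c ∈ fixedPoints H s, AbsGal.ext s q.1.out c ≠ c := by
    intro q
    by_contra! hn
    exact q.2 (hgen _ hn)
  choose f hf hfne using hmoved
  have hout : ∀ (σ : AbsGal L A) {c : M s}, c ∈ fixedPoints H s →
      AbsGal.ext s (σ : AbsGal L A ⧸ H).out c = AbsGal.ext s σ c := by
    intro σ c hc
    have := (mem_fixedPoints.1 hc).2 _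
      (QuotientGroup.eq.1 (Quotient.out_eq (σ : AbsGal L A ⧸ H)))
    rw [AbsGal.ext_mul, AbsGal.ext_inv_eq_iff] at this
    exact this.symm
  refine ⟨Set.range f, ?_, ?_, ?_, fun σ => ?_⟩
  · rintro _ ⟨q, rfl⟩
    exact fixedPoints_subset_acl H s (hf q)
  · exact (encard_range_le f).trans (ENat.card_le_card_of_injective Subtype.val_injective)
  · rintro _ ⟨q, rfl⟩
    refine le_trans (Set.encard_le_encard (t := Set.range fun q' : AbsGal L A ⧸ H =>
      AbsGal.ext s q'.out (f q)) ?_) (encard_range_le _)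
    rintro _ ⟨σ, rfl⟩
    exact ⟨(σ : AbsGal L A ⧸ H), hout σ (hf q)⟩
  · rw [Set.forall_mem_range]
    constructor
    · intro h
      by_contra hσ
      have hq : (σ : AbsGal L A ⧸ H).out ∉ H := by
        intro hmem
        refine hσ ?_
        have := H.mul_mem hmem (QuotientGroup.eq.1 (Quotient.out_eq (σ : AbsGal L A ⧸ H)))
        rwa [mul_inv_cancel_left] at this
      refine hfne ⟨_, hq⟩ ?_
      rw [hout σ (hf _)]
      exact h _
    · intro h q
      exact (mem_fixedPoints.1 (hf q)).2 σ h

include hQE hM in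
/-- A sorted isomorphism translates the condition of fixing the orbit of an element into the
condition of fixing a set, of bounded size, of elements of the same sort with orbits of bounded
size. -/
theorem IsSorted.exists_controlling (hEI : T.HasEI) {A B : ∀ s, Set (M s)}
    (φ : AbsGal L A ≃ₜ* AbsGal L B) (hφ : IsSorted (φ : AbsGal L A →* AbsGal L B)) {d : M s}
    (hd : d ∈ acl L B s) {n : ℕ}
    (hn : (Set.range fun ρ : AbsGal L B => AbsGal.ext s ρ d).encard ≤ n) :
    ∃ C : Set (M s), C ⊆ acl L A s ∧ C.encard ≤ (n ^ n : ℕ) ∧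
      (∀ c ∈ C, (Set.range fun σ : AbsGal L A => AbsGal.ext s σ c).encard ≤ (n ^ n : ℕ)) ∧
      ∀ σ : AbsGal L A, (∀ c ∈ C, AbsGal.ext s σ c = c) ↔
        ∀ z ∈ Set.range fun ρ : AbsGal L B => AbsGal.ext s ρ d, AbsGal.ext s (φ σ) z = z := by
  have hn' := card_quotient_orbitFixer_le hQE hM hn
  obtain ⟨H', hH'⟩ : ∃ H' : Subgroup (AbsGal L B), H' = orbitFixer d := ⟨_, rfl⟩
  have hmem : ∀ τ, τ ∈ H' ↔ ∀ ρ : AbsGal L B,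
      AbsGal.ext s τ (AbsGal.ext s ρ d) = AbsGal.ext s ρ d := by
    rw [hH']; exact fun τ => Iff.rfl
  have hH'n : H'.Normal := hH' ▸ orbitFixer_normal d
  have hH'o : IsOpen (H' : Set (AbsGal L B)) := hH' ▸ isOpen_orbitFixer hQE hM hd
  rw [← hH'] at hn'
  -- The orbit of `d` is contained in sort `s` and in the fixed points of its stabilizer `H'`, so
  -- sort `s` generates these fixed points and sortedness applies.
  have hgen' : ∀ ρ : AbsGal L B, (∀ x ∈ fixedPoints H' s, AbsGal.ext s ρ x = x) → ρ ∈ H' :=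
    fun ρ hρ => (hmem ρ).2 fun ρ' =>
      hρ _ (mem_fixedPoints.2 ⟨ρ'.ext_mem hd, fun τ hτ => (hmem τ).1 hτ ρ'⟩)
  have hgen := (mk_autSort_eq_iff hQE hM hEI (hH'n.comap (φ : AbsGal L A →* AbsGal L B))
    (hH'o.preimage φ.continuous_toFun) s).1
    (hφ H' hH'n hH'o s ((mk_autSort_eq_iff hQE hM hEI hH'n hH'o s).2 hgen'))
  have hcard : ENat.card (AbsGal L A ⧸ H'.comap (φ : AbsGal L A →* AbsGal L B)) ≤
      (n ^ n : ℕ) := by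
    refine le_trans ?_ hn'
    refine ENat.card_le_card_of_injective
      (f := fun q => ((φ q.out : AbsGal L B) : AbsGal L B ⧸ H')) fun q q' h => ?_
    rw [← q.out_eq, ← q'.out_eq]
    refine QuotientGroup.eq.2 ?_
    have := QuotientGroup.eq.1 h
    rwa [← map_inv, ← map_mul] at this
  obtain ⟨C, hCA, hC, horb, hiff⟩ := exists_generating hgen
  refine ⟨C, hCA, hC.trans hcard, fun c hc => (horb c hc).trans hcard, fun σ => ?_⟩
  rw [hiff, Set.forall_mem_range, Subgroup.mem_comap, hmem]
  rfl

end Levels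

/-! ### Ultralimits of sorted isomorphisms -/

section Main

variable {S : Type u} {L : Language S} {I : Type u} {U : Ultrafilter I} {M : S → Type u}
  [Structure L M] {F E : I → ∀ s, Set (M s)} {T : Theory L} (hQE : T.HasQE) (hM : T.IsModel M)

/-- The controlling sets exist coordinatewise with bounds depending only on `n`, so their
ultraproduct is a finite set of algebraic elements. The abstract group `P` allows both directions,
through `φ` and through its inverse, to use the same source. -/
theorem controls_ulim (hEI : T.HasEI) (hF : ∀ i, IsDefinablyClosed L (F i))
    (φ : ∀ i, AbsGal L (F i) ≃ₜ* AbsGal L (E i))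
    (hφ : ∀ i, IsSorted (φ i : AbsGal L (F i) →* AbsGal L (E i)))
    {P : Type*} [Group P] (p : P →* ∀ i, AbsGal L (F i)) (q : P →* ∀ i, AbsGal L (E i))
    (hpq : ∀ σ i, q σ i = φ i (p σ i)) :
    Controls ((ulim U F hQE hM).comp p) ((ulim U E hQE hM).comp q) := by
  intro s y hy
  obtain ⟨d, rfl⟩ := exists_coe U y
  have hd := eventually_mem_acl hy
  obtain ⟨n, hn⟩ := exists_bound_orbit hQE hM hy
  obtain ⟨C, hC⟩ := exists_seq_const U (α := Set (M s)) ((hd.and hn).mono fun i hi =>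
    (hφ i).exists_controlling hQE hM hEI (φ i) hi.1 hi.2)
  let O : I → Set (M s) := fun i => Set.range fun ρ : AbsGal L (E i) => AbsGal.ext s ρ (d i)
  have hCacl : ultraSet U C ⊆ acl L (ultraproduct U F) s := by
    intro x hx
    obtain ⟨c, rfl⟩ := exists_coe U x
    have hc := coe_mem_ultraSet.1 hx
    refine mem_acl_ultraproduct hQE hM hEI hF (n := n ^ n) ?_ ?_
    · filter_upwards [hc, hC] with i h₁ h₂
      exact h₂.1 h₁
    · filter_upwards [hc, hC] with i h₁ h₂
      exact h₂.2.2.1 _ h₁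
  have hOorb : ∀ z ∈ ultraSet U O, ∃ ρ : AbsGal L (ultraproduct U E),
      AbsGal.ext s ρ (d : Ultrapower U M s) = z := by
    intro z hz
    obtain ⟨a, rfl⟩ := exists_coe U z
    obtain ⟨ρ, hρ⟩ := exists_seq U (coe_mem_ultraSet.1 hz)
    refine ⟨ulim U E hQE hM ρ, ?_⟩
    rw [ext_ulim _ _ _ hy]
    exact Filter.Germ.coe_eq.2 hρ
  have hOacl : ultraSet U O ⊆ acl L (ultraproduct U E) s := by
    intro z hz
    obtain ⟨ρ, rfl⟩ := hOorb z hz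
    exact ρ.ext_mem hy
  refine ⟨ultraSet U C, ultraSet U O, ?_, hCacl, ?_, ?_, hOorb, fun σ => ?_⟩
  · exact Set.encard_lt_top_iff.1
      ((eventually_encard_le.1 (hC.mono fun i hi => hi.2.1)).trans_lt (ENat.natCast_lt_top _))
  · exact Set.encard_lt_top_iff.1 ((eventually_encard_le.1 hn).trans_lt (ENat.natCast_lt_top _))
  · exact coe_mem_ultraSet.2 (Filter.Eventually.of_forall fun i => ⟨1, AbsGal.ext_one _ _⟩)
  · rw [MonoidHom.comp_apply, MonoidHom.comp_apply, fixes_ulim_iff hQE hM hCacl,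
      fixes_ulim_iff hQE hM hOacl]
    refine Filter.eventually_congr ?_
    filter_upwards [hC] with i hi
    rw [hpq]
    exact hi.2.2.2 _

/-- The coordinatewise action does not depend on representatives, so being an ultralimit on `X` is
agreement with `ulim` there. -/
theorem isUltralimitOn_iff {X : ∀ s, Set (Ultrapower U M s)} {σ : ∀ i, AbsGal L (F i)}
    {τ : AbsGal L (ultraproduct U F)} :
    IsUltralimitOn X σ τ ↔ ∀ s, ∀ x ∈ acl L (ultraproduct U F) s, x ∈ X s →
      AbsGal.ext s (ulim U F hQE hM σ) x = AbsGal.ext s τ x := by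
  constructor
  · intro h s x hx hxX
    obtain ⟨c, d, hc, hd, hcd⟩ := h s ⟨x, hx⟩ hxX
    rw [AbsGal.ext_of_mem τ hx, hd]
    simp only at hc
    subst hc
    rw [ext_ulim _ _ _ hx]
    refine Filter.Germ.coe_eq.2 (hcd.mono fun i hi => ?_)
    obtain ⟨h, hi⟩ := hi
    simp only
    rw [AbsGal.ext_of_mem _ h, hi]
  · rintro h s ⟨x, hx⟩ hxX
    obtain ⟨a, rfl⟩ := exists_coe U x
    refine ⟨a, fun i => AbsGal.ext s (σ i) (a i), rfl, ?_, ?_⟩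
    · rw [← AbsGal.ext_of_mem τ hx, ← h s _ hx hxX, ext_ulim _ _ _ hx]
    · filter_upwards [eventually_mem_acl hx] with i hi
      exact ⟨hi, (AbsGal.ext_of_mem _ hi).symm⟩

end Main

end ManySorted

end

theorem mainTheorem4 {S : Type u} {L : ManySorted.Language S} (T : ManySorted.Theory L)
    (hQE : T.HasQE) (hEI : T.HasEI)
    (M : S → Type u) [ManySorted.Structure L M] (hM : T.IsModel M)
    {I : Type u} (U : Ultrafilter I)
    (E F : I → ∀ s, Set (M s))
    (hE : ∀ i, ManySorted.IsDefinablyClosed L (E i))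
    (hF : ∀ i, ManySorted.IsDefinablyClosed L (F i))
    (φ : ∀ i, ManySorted.AbsGal L (F i) ≃ₜ* ManySorted.AbsGal L (E i))
    (hφ : ∀ i, ManySorted.IsSortedIso (φ i)) :
    ∃ Φ : ManySorted.AbsGal L (ManySorted.ultraproduct U F) ≃ₜ*
        ManySorted.AbsGal L (ManySorted.ultraproduct U E),
      ManySorted.IsSortedIso Φ ∧
      ∀ H : Subgroup (ManySorted.AbsGal L (ManySorted.ultraproduct U F)), H.Normal →
        IsOpen (H : Set (ManySorted.AbsGal L (ManySorted.ultraproduct U F))) →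
        ∀ τ : ManySorted.AbsGal L (ManySorted.ultraproduct U F),
          (∃ σ : ∀ i, ManySorted.AbsGal L (F i),
            ManySorted.IsUltralimitOn (ManySorted.fixedPoints H) σ τ) ∧
          ∀ σ : ∀ i, ManySorted.AbsGal L (F i),
            ManySorted.IsUltralimitOn (ManySorted.fixedPoints H) σ τ →
            ManySorted.IsUltralimitOn
              (ManySorted.fixedPoints
                (H.map (Φ : ManySorted.AbsGal L (ManySorted.ultraproduct U F) →*
                  ManySorted.AbsGal L (ManySorted.ultraproduct U E))))
              (fun i => φ i (σ i)) (Φ τ) := by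
  open ManySorted in
  -- The product of the groups `𝒢(F_i)` is the common source; `q` carries it to the product of the
  -- `𝒢(E_i)`.
  let q : (∀ i, AbsGal L (F i)) →* ∀ i, AbsGal L (E i) :=
    { toFun := fun σ i => φ i (σ i)
      map_one' := by funext i; exact map_one (φ i)
      map_mul' := fun σ τ => by funext i; exact map_mul (φ i) _ _ }
  have hN := hM.ultrapower U
  have hlk := controls_ulim (U := U) hQE hM hEI hF φ (fun i => (hφ i).1) (MonoidHom.id _) q
    (fun _ _ => rfl)
  have hkl := controls_ulim (U := U) hQE hM hEI hE (fun i => (φ i).symm) (fun i => (hφ i).2) q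
    (MonoidHom.id _) (fun σ i => ((φ i).symm_apply_apply (σ i)).symm)
  have hl : IsDenseHom ((ulim U F hQE hM).comp (MonoidHom.id _)) := fun τ C hC hCA =>
    exists_ulim_eqOn hQE hM hEI hF τ hC hCA
  have hk : IsDenseHom ((ulim U E hQE hM).comp q) := fun τ C hC hCA => by
    obtain ⟨σ, hσ⟩ := exists_ulim_eqOn hQE hM hEI hE τ hC hCA
    refine ⟨fun i => (φ i).symm (σ i), ?_⟩
    have : q (fun i => (φ i).symm (σ i)) = σ := by
      funext i; exact (φ i).apply_symm_apply (σ i)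
    rwa [MonoidHom.comp_apply, this]
  obtain ⟨Φ, hΦ, hcomp⟩ := exists_sortedIso hQE hN hEI hl hk hlk hkl
  refine ⟨Φ, hΦ, fun H hHn hH τ => ⟨?_, fun σ hσ => ?_⟩⟩
  · obtain ⟨C, hC, hCA, hCH⟩ := Subgroup.isOpen_iff_absGal.1 hH
    obtain ⟨σ, hσ⟩ := exists_ulim_eqOn hQE hM hEI hF τ hC hCA
    -- Agreement with `τ` on the finite set `C` already gives the same coset of `H`, hence agreement
    -- on all fixed points of `H`.
    have hmem : τ⁻¹ * ulim U F hQE hM σ ∈ H := hCH _ fun p hp => by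
      rw [AbsGal.ext_mul, hσ p hp, AbsGal.ext_inv_ext]
    refine ⟨σ, (isUltralimitOn_iff hQE hM).2 fun s x _ hxH => ?_⟩
    have := (mem_fixedPoints.1 hxH).2 _ hmem
    rwa [AbsGal.ext_mul, AbsGal.ext_inv_eq_iff] at this
  · rw [isUltralimitOn_iff hQE hM] at hσ ⊢
    -- Conversely, agreement on the fixed points of the open subgroup `H` means equality modulo `H`;
    -- this is carried by `Φ` to equality modulo the image of `H`.
    have hmem : τ⁻¹ * ulim U F hQE hM σ ∈ H :=
      mem_of_fixes_fixedPoints hQE hN hEI hH fun s x hx => by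
        rw [AbsGal.ext_mul, hσ s x (fixedPoints_subset_acl H s hx) hx, AbsGal.ext_inv_ext]
    intro s x _ hx
    have := (mem_fixedPoints.1 hx).2 _ (Subgroup.mem_map_of_mem _ hmem)
    have hΦσ : Φ (ulim U F hQE hM σ) = ulim U E hQE hM (fun i => φ i (σ i)) := hcomp σ
    rw [← hΦσ]
    rw [map_mul, map_inv, AbsGal.ext_mul, AbsGal.ext_inv_eq_iff] at this
    exact this
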